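/- Let $\mathfrak g$ be a finite-dimensional complex simple Lie algebra with Cartan subalgebra $\mathfrak h$ and root system $\Delta$. Fix a positive system $\Delta^+$ with simple roots $\alpha_1,\dots,\alpha_n$ and highest root $\theta$. Let $\mathfrak b=\mathfrak h\oplus\bigoplus_{\alpha\in\Delta^+}\mathfrak g_\alpha$ be the corresponding Borel subalgebra, $W$ the Weyl group, and $P^\vee=\{x\in\mathfrak h\mid (x,\alpha)\in\mathbb Z\ \ \forall\alpha\in\Delta\}$ the coweight lattice, where $(x,\alpha)=\alpha(x)$. Put $$\widetilde Z=\{z\in P^\vee\mid (z,\alpha_i)\le 1\ (1\le i\le n),\ (z,\theta)\ge -2\},$$ $$\widetilde Z_{ab}=\{z\in P^\vee\mid (z,\beta)\in\{0,-1,1,-2\}\ \ \forall \beta\in\Delta^+\},$$ $$X=\{\tau\in P^\vee\mid (\tau,\alpha_i)\ge 0\ (1\le i\le n),\ (\tau,\theta)\le 2\}.$$ For $w\in W$ let $N(w)=\{\alpha\in\Delta^+\mid w^{-1}\alpha\in-\Delta^+\}$. For $z\in P^\vee$ there is a unique $v_z\in W$ with $N(v_z)=\{\alpha\in\Delta^+\mid(\alpha,z)<0\}$;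 put $dom(z)=v_z^{-1}(z)$ and $\Delta^1_z=\{\alpha\in\Delta^+\mid(\alpha,z)=1\}$. For a set $\Phi$ of roots put $\mathfrak i(\Phi)=\bigoplus_{\alpha\in\Phi}\mathfrak g_\alpha$. Let $\tau\in X$, let $\Theta_\tau=\mathrm{Ad}(\exp(\sqrt{-1}\,\pi\tau))=\exp(\mathrm{ad}(\sqrt{-1}\,\pi\tau))$, and let $\mathfrak k_\tau$ and $\mathfrak p_\tau$ be its $(+1)$- and $(-1)$-eigenspaces in $\mathfrak g$. Let $W_\tau$ be the Weyl group of $(\mathfrak k_\tau,\mathfrak h)$, that is, the subgroup of $W$ generated by the reflections in the roots $\alpha$ with $\mathfrak g_\alpha\subset\mathfrak k_\tau$, and let $n_\tau=[W:W_\tau]$. Put $\widehat Z_\tau=dom^{-1}(\tau)\cap\widetilde Z$ and $\widetilde Z_\tau=dom^{-1}(\tau)\cap\widetilde Z_{ab}$. Then the map $z\mapsto\mathfrak i(v_z^{-1}(\Delta^1_z))$ is a bijection from $\widehat Z_\tau$ onto the set of $\mathfrak b\cap\mathfrak k_\tau$-submodules (for the adjoint action) of $\mathfrak b\cap\mathfrak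 p_\tau$. Moreover $\widetilde Z_\tau\subseteq\widehat Z_\tau$, and the map restricts to a bijection from $\widetilde Z_\tau$ onto the set of those submodules $\mathfrak s$ that are abelian, i.e. $[\mathfrak s,\mathfrak s]=0$. In particular there are exactly $n_\tau$ abelian $\mathfrak b\cap\mathfrak k_\tau$-submodules of $\mathfrak b\cap\mathfrak p_\tau$. -/

import Mathlib

open LieAlgebra LieAlgebra.IsKilling

noncomputable section

namespace CompatibleDS

variable {L : Type*} [LieRing L] [LieAlgebra ℂ L] [FiniteDimensional ℂ L] [LieAlgebra.IsSimple ℂ L]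
  {H : LieSubalgebra ℂ L} [H.IsCartanSubalgebra]

/-! ### Root-theoretic data

`L` is the simple Lie algebra, `H` its Cartan subalgebra, `Δ = H.root` its set of roots (with root
system `rootSystem H`), and the positive system `Δ⁺` is the one of a base `b`. -/

/-- The finite Weyl group `W`. -/
abbrev Weyl (H : LieSubalgebra ℂ L) [H.IsCartanSubalgebra] : Type _ :=
  (rootSystem H).weylGroup

/-- The action of the Weyl group on the roots. -/
def actRoot (w : Weyl H) (α : H.root) : H.root :=
  (rootSystem H).weylGroupToPerm w α

/-- The action of the Weyl group on the Cartan subalgebra, `(w x)(α) = x(w⁻¹ α)`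
(Mathlib's `coweightMap` is the transpose of the action on the dual space). -/
def actCartan (w : Weyl H) (x : H) : H :=
  RootPairing.Hom.coweightMap (w⁻¹ : Weyl H).1.toHom x

theorem root_actCartan (w : Weyl H) (α : H.root) (x : H) :
    (rootSystem H).root α (actCartan w x) = (rootSystem H).root (actRoot w⁻¹ α) x := by
  have h1 := LinearMap.congr_fun
    (RootPairing.Hom.weight_coweight_transpose_apply _ _ x (w⁻¹ : Weyl H).1.toHom)
    ((rootSystem H).root α)
  have h2 : (w⁻¹ : Weyl H).1.toHom.weightMap ((rootSystem H).root α) =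
      (rootSystem H).root (actRoot w⁻¹ α) := RootPairing.Hom.root_weightMap_apply _ _ _ _
  rw [← h2]
  exact h1.symm

/-- The pairing `(x, α)`. It is only used for `x` in the coweight lattice, where `α x` is an
integer, so that taking the real part changes nothing. -/
def pair (x : H) (α : H.root) : ℝ := ((rootSystem H).root α x).re

/-- The coweight lattice `P^∨`: the dual lattice of the root lattice. -/
def coweights (H : LieSubalgebra ℂ L) [H.IsCartanSubalgebra] : Set H :=
  {x | ∀ α : H.root, ∃ k : ℤ, (rootSystem H).root α x = k}

/-- `θ` is the highest root: `θ - β` is a sum of simple roots for every root `β`. -/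
def IsHighestRoot (b : (rootSystem H).Base) (θ : H.root) : Prop :=
  ∀ β : H.root, (rootSystem H).root θ - (rootSystem H).root β ∈
    AddSubmonoid.closure ((rootSystem H).root '' b.support)

/-- `Z̃`: the coweights `z` with `(z, αᵢ) ≤ 1` for all simple `αᵢ` and `(z, θ) ≥ -2`, where `θ` is
the highest root. -/
def tildeZ (b : (rootSystem H).Base) : Set H :=
  {z | z ∈ coweights H ∧ (∀ i ∈ b.support, pair z i ≤ 1) ∧
    ∀ θ, IsHighestRoot b θ → -2 ≤ pair z θ}

/-- `Z̃_ab`: the coweights `z` with `(z, β) ∈ {0, -1, 1, -2}` for all positive roots `β`. -/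
def tildeZab (b : (rootSystem H).Base) : Set H :=
  {z | z ∈ coweights H ∧ ∀ β, b.IsPos β → pair z β ∈ ({0, -1, 1, -2} : Set ℝ)}

/-- `X`: the coweights in the closed alcove `C̄₂`, i.e. the coweights `τ` with `(τ, αᵢ) ≥ 0` for
all simple `αᵢ` and `(τ, θ) ≤ 2`. -/
def alcoveX (b : (rootSystem H).Base) : Set H :=
  {τ | τ ∈ coweights H ∧ (∀ i ∈ b.support, 0 ≤ pair τ i) ∧
    ∀ θ, IsHighestRoot b θ → pair τ θ ≤ 2}

/-- `Δ¹_z`: the positive roots `α` with `(α, z) = 1`. -/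
def deltaOne (b : (rootSystem H).Base) (z : H) : Set H.root :=
  {α | b.IsPos α ∧ pair z α = 1}

/-- `N(w)`: the positive roots `α` such that `w⁻¹ α` is negative. -/
def inversions (b : (rootSystem H).Base) (w : Weyl H) : Set H.root :=
  {α | b.IsPos α ∧ ¬ b.IsPos (actRoot w⁻¹ α)}

/-- The defining property of `v_z`: `N(v) = {α ∈ Δ⁺ | (α, z) < 0}`. -/
def IsV (b : (rootSystem H).Base) (z : H) (v : Weyl H) : Prop :=
  inversions b v = {α | b.IsPos α ∧ pair z α < 0}

/-- The element `v_z` of the Weyl group. -/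
def vOf (b : (rootSystem H).Base) (z : H) : Weyl H :=
  Classical.epsilon (IsV b z)

/-- `dom(z) = v_z⁻¹(z)`. -/
def dom (b : (rootSystem H).Base) (z : H) : H :=
  actCartan (vOf b z)⁻¹ z

/-- `dom⁻¹(τ) ∩ Z̃`. -/
def hatZ (b : (rootSystem H).Base) (τ : H) : Set H :=
  {z | z ∈ tildeZ b ∧ dom b z = τ}

/-- `Z̃_τ = dom⁻¹(τ) ∩ Z̃_ab`. -/
def tildeZtau (b : (rootSystem H).Base) (τ : H) : Set H :=
  {z | z ∈ tildeZab b ∧ dom b z = τ}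

/-! ### Subspaces of the Lie algebra -/

/-- The root space `𝔤_α`, as a subspace of `L`. -/
def rootSp (α : H.root) : Submodule ℂ L := (rootSpace H (α.1 : H → ℂ)).toSubmodule

/-- `𝔦(Φ)`: the direct sum of the root spaces `𝔤_α`, `α ∈ Φ`. -/
def sumRootSp (Φ : Set H.root) : Submodule ℂ L := ⨆ α ∈ Φ, rootSp α

/-- The Borel subalgebra `𝔟`: the sum of `𝔥` and of the positive root spaces. -/
def borel (b : (rootSystem H).Base) : Submodule ℂ L :=
  H.toSubmodule ⊔ sumRootSp {α | b.IsPos α}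

/-- The involution `Θ_τ = Ad(exp(iπτ)) = exp(ad(iπτ))` of `L`. The exponential of an endomorphism
is computed through its matrix in a basis of `L` (it does not depend on the basis). -/
def cartanInv (τ : H) : Module.End ℂ L :=
  Matrix.toLin (Module.finBasis ℂ L) (Module.finBasis ℂ L)
    (NormedSpace.exp (LinearMap.toMatrix (Module.finBasis ℂ L) (Module.finBasis ℂ L)
      (LieAlgebra.ad ℂ L (((Real.pi : ℂ) * Complex.I) • (τ : L)))))

/-- `𝔨_τ`: the fixed points of `Θ_τ`. -/
def kSub (τ : H) : Submodule ℂ L := Module.End.eigenspace (cartanInv τ) 1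

/-- `𝔭_τ`: the `(-1)`-eigenspace of `Θ_τ`. -/
def pSub (τ : H) : Submodule ℂ L := Module.End.eigenspace (cartanInv τ) (-1)

/-- `𝒮_τ`: the set of `𝔟 ∩ 𝔨_τ`-submodules of `𝔟 ∩ 𝔭_τ` (for the adjoint action). -/
def submodulesS (b : (rootSystem H).Base) (τ : H) : Set (Submodule ℂ L) :=
  {s | s ≤ borel b ⊓ pSub τ ∧ ∀ x ∈ borel b ⊓ kSub τ, ∀ y ∈ s, ⁅x, y⁆ ∈ s}

/-- The abelian members of `𝒮_τ`. -/
def abelianS (b : (rootSystem H).Base) (τ : H) : Set (Submodule ℂ L) :=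
  {s | s ∈ submodulesS b τ ∧ ∀ x ∈ s, ∀ y ∈ s, ⁅x, y⁆ = 0}

/-- `W_τ`: the Weyl group of `(𝔨_τ, 𝔥)`, i.e. the subgroup of `W` generated by the reflections in
the roots `α` with `𝔤_α ⊆ 𝔨_τ`. -/
def weylTau (τ : H) : Subgroup (Weyl H) :=
  Subgroup.closure (RootPairing.weylGroup.ofIdx (rootSystem H) '' {α | rootSp α ≤ kSub τ})

/-- `n_τ`: the index of `W_τ` in `W`. -/
def nTau (τ : H) : ℕ := (weylTau τ).index

/-- The map `z ↦ 𝔦(v_z⁻¹(Δ¹_z))`. -/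
def idealMap (b : (rootSystem H).Base) (z : H) : Submodule ℂ L :=
  sumRootSp (actRoot (vOf b z)⁻¹ '' deltaOne b z)

end CompatibleDS

end

/-! Call `(τ, α)` the level of `α`. For `τ ∈ X` the levels of positive roots are 0, 1 or 2, and
`Θ_τ` acts on a root space by the parity of the level. Thus a submodule of `𝔟 ∩ 𝔭_τ` is a sum of
root spaces over a set `Φ` of level-one roots stable under adding positive roots of level zero;
roots of level two cannot be added, since no root has level three. It is abelian exactly when no sum
of two elements of `Φ` is a root.

On the other side, `z` with `dom z = τ` is `v τ` for `v = v_z`, and `(z, β)` is the level of `v⁻¹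
β`. The elements `v` that occur are those keeping positive roots of level zero positive. Membership
in `Z̃` says that `v` sends no root of level two to a simple root, and membership in `Z̃_ab` that it
sends all of them to negative roots. The set attached to `v` is that of the level-one roots made
positive by `v`.

Such a `v` is recovered from `Φ`: a level-two root is made positive by `v` exactly when it is a sum
of two elements of `Φ` (`pos_smul_iff_mem_rootSums`). Conversely, for each stable `Φ`, these
prescriptions on levels 0, 1, 2, extended to opposites by complement, define a positive system
(`isPositiveSystem_levelPos`), hence an element of `W`. Both directions rest on
`add_mem_or_of_add_add`. The abelian case is the one where no level-two root becomes positive.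

For the count, these last `v` are the ones mapping a fixed positive system of the even-level roots
into `Δ⁺`, so they represent the cosets of `W_τ`. The facts on Weyl groups are therefore proved for
a closed symmetric subset `D` of the roots, with the even-level roots as one case and all roots as
another. -/

open RootPairing

noncomputable section

namespace CompatibleDS

/-! ### Reflections acting on roots, and sums of three roots. -/

section RootCombinatorics

variable {ι R M N : Type*} [CommRing R] [AddCommGroup M] [Module R M] [AddCommGroup N] [Module R N]
  {P : RootPairing ι R M N}

/-! ### The Weyl group acting on the indices of roots -/

theorem root_smul (w : P.weylGroup) (i : ι) : P.root (w • i) = w • P.root i :=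
  (Hom.root_weightMap_apply _ _ _ _).symm

theorem ofIdx_smul_index (i j : ι) : weylGroup.ofIdx P i • j = P.reflectionPerm i j := rfl

theorem smul_index_add (w : P.weylGroup) {i j k : ι} (h : P.root k = P.root i + P.root j) :
    P.root (w • k) = P.root (w • i) + P.root (w • j) := by
  rw [root_smul, root_smul, root_smul, h, smul_add]

theorem root_opp (i : ι) : P.root (P.reflectionPerm i i) = -P.root i := by simp

theorem smul_opp (w : P.weylGroup) (i : ι) :
    w • P.reflectionPerm i i = P.reflectionPerm (w • i) (w • i) := by
  apply P.root.injective
  rw [root_smul, root_opp, root_opp, smul_neg, root_smul]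

theorem opp_opp (i : ι) :
    P.reflectionPerm (P.reflectionPerm i i) (P.reflectionPerm i i) = i := by
  apply P.root.injective
  rw [root_opp, root_opp, neg_neg]

theorem eq_opp_iff {i j : ι} : i = P.reflectionPerm j j ↔ P.root i = -P.root j := by
  rw [← root_opp, P.root.injective.eq_iff]

theorem root_reflectionPerm_eq [P.IsCrystallographic] [CharZero R] (i j : ι) :
    P.root (P.reflectionPerm i j) = P.root j - P.pairingIn ℤ j i • P.root i := by
  rw [root_reflectionPerm, reflection_apply_root' ℤ]

theorem pairing_smul_smul (w : P.weylGroup) (i j : ι) :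
    P.pairing (w • i) (w • j) = P.pairing i j := by
  have key : ∀ (g : P.Aut), g ∈ P.weylGroup → ∀ i j, P.pairing (g • i) (g • j) = P.pairing i j := by
    intro g hg
    induction hg using weylGroup.induction with
    | mem k =>
      intro i j
      change P.pairing (P.reflectionPerm k i) (P.reflectionPerm k j) = _
      rw [← pairing_reflectionPerm, reflectionPerm_self]
    | one => intro i j; rw [one_smul, one_smul]
    | mul x y hx hy ihx ihy => intro i j; rw [mul_smul, mul_smul, ihx, ihy]
  exact key w.1 w.2 i j

theorem weylGroup_ext [P.IsRootSystem] {w w' : P.weylGroup} (h : ∀ i : ι, w • i = w' • i) :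
    w = w' := by
  apply Subtype.ext
  apply Equiv.weightHom_injective P
  apply LinearEquiv.toLinearMap_injective
  refine LinearMap.ext_on (s := Set.range P.root) IsRootSystem.span_root_eq_top ?_
  rintro _ ⟨i, rfl⟩
  have h1 := congrArg P.root (h i)
  rw [root_smul, root_smul] at h1
  exact h1

theorem ofIdx_mul_self (i : ι) : weylGroup.ofIdx P i * weylGroup.ofIdx P i = 1 := by
  apply Subtype.ext
  change Equiv.reflection P i * Equiv.reflection P i = 1
  rw [mul_eq_one_iff_inv_eq, Equiv.reflection_inv P i]

theorem ofIdx_inv (i : ι) : (weylGroup.ofIdx P i)⁻¹ = weylGroup.ofIdx P i :=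
  inv_eq_of_mul_eq_one_left (ofIdx_mul_self i)

theorem conj_ofIdx [P.IsRootSystem] (w : P.weylGroup) (i : ι) :
    w * weylGroup.ofIdx P i * w⁻¹ = weylGroup.ofIdx P (w • i) := by
  apply weylGroup_ext
  intro j
  obtain ⟨j, rfl⟩ : ∃ k, j = w • k := ⟨w⁻¹ • j, by rw [smul_inv_smul]⟩
  rw [mul_smul, inv_smul_smul, mul_smul]
  apply P.root.injective
  have hlin : ∀ (c : R) (x : M), w • (c • x) = c • w • x := fun c x => by
    exact map_smul (Equiv.weightHom P w.1) c x
  rw [ofIdx_smul_index, ofIdx_smul_index, root_smul, root_reflectionPerm, root_reflectionPerm,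
    reflection_apply_root, reflection_apply_root, pairing_smul_smul, root_smul, root_smul,
    smul_sub, hlin]

theorem ofIdx_opp [P.IsRootSystem] (i : ι) :
    weylGroup.ofIdx P (P.reflectionPerm i i) = weylGroup.ofIdx P i := by
  rw [← ofIdx_smul_index, ← conj_ofIdx, ofIdx_mul_self, one_mul, ofIdx_inv]

instance finite_weylGroup [P.IsRootSystem] [Finite ι] : Finite P.weylGroup :=
  Finite.of_injective (fun w : P.weylGroup => (fun i : ι => w • i))
    fun _ _ h => weylGroup_ext fun i => congrFun h i

/-! ### Sums of three roots -/

variable [Finite ι] [IsDomain R] [CharZero R] [P.IsCrystallographic]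

/-- If `p + q` and `p + q + r` are roots, then `p + r` or `q + r` is a root, unless it is zero. -/
theorem add_mem_or_of_add_add {p q r a k : ι} (ha : P.root a = P.root p + P.root q)
    (hk : P.root k = P.root a + P.root r) (hp : P.root r ≠ -P.root p)
    (hq : P.root r ≠ -P.root q) :
    (∃ l, P.root l = P.root p + P.root r) ∨ ∃ l, P.root l = P.root q + P.root r := by
  have hpk : p ≠ k := by
    rintro rfl
    apply hq
    rw [ha] at hk
    exact eq_neg_of_add_eq_zero_right (left_eq_add.1 (hk.trans (add_assoc _ _ _)))
  have hqk : q ≠ k := by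
    rintro rfl
    apply hp
    rw [ha] at hk
    exact eq_neg_of_add_eq_zero_right
      (left_eq_add.1 (hk.trans ((add_assoc _ _ _).trans (add_left_comm _ _ _))))
  -- If neither sum is a root, `p` and `q` pair nonnegatively with `r`, hence so does `a`. Then `⟨k,
  -- a⟩ = 2 + ⟨r, a⟩ > 0`, so `p` or `q` pairs positively with `k`, and `k - p = q + r` or `k - q =
  -- p + r` is a root after all.
  by_contra! hcon
  have h1 : 0 ≤ P.pairingIn ℤ p r := by
    by_contra! hneg
    obtain ⟨l, hl⟩ := P.root_add_root_mem_of_pairingIn_neg hneg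
      (fun h => hp (by rw [h, neg_neg]))
    exact hcon.1 l hl
  have h2 : 0 ≤ P.pairingIn ℤ q r := by
    by_contra! hneg
    obtain ⟨l, hl⟩ := P.root_add_root_mem_of_pairingIn_neg hneg
      (fun h => hq (by rw [h, neg_neg]))
    exact hcon.2 l hl
  have h3 : 0 ≤ P.pairingIn ℤ r a := by
    have h : 0 ≤ P.pairingIn ℤ a r := by
      rw [pairingIn_eq_add_of_root_eq_add ha]; exact add_nonneg h1 h2
    by_contra! hneg
    exact absurd ((P.pairingIn_lt_zero_iff ℤ).1 hneg) (not_lt.2 h)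
  have h4 : 0 < P.pairingIn ℤ a k := by
    rw [P.zero_lt_pairingIn_iff', pairingIn_eq_add_of_root_eq_add hk, pairingIn_same]
    lia
  rw [pairingIn_eq_add_of_root_eq_add ha] at h4
  have h5 : 0 < P.pairingIn ℤ p k ∨ 0 < P.pairingIn ℤ q k := by lia
  rcases h5 with h5 | h5
  · obtain ⟨l, hl⟩ := P.root_sub_root_mem_of_pairingIn_pos h5 hpk
    apply hcon.2 (P.reflectionPerm l l)
    rw [root_opp, hl, hk, ha]
    module
  · obtain ⟨l, hl⟩ := P.root_sub_root_mem_of_pairingIn_pos h5 hqk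
    apply hcon.1 (P.reflectionPerm l l)
    rw [root_opp, hl, hk, ha]
    module

end RootCombinatorics

/-! ### Conjugacy of positive systems, exchange, and coset representatives for reflection subgroups.
-/

section PositiveSystems

variable {ι R M N : Type*} [CommRing R] [AddCommGroup M] [Module R M] [AddCommGroup N] [Module R N]

/-! ### Positive systems of closed symmetric sets of roots -/

/-- An integer-valued function on the roots that is additive. -/
structure IsAdditive (P : RootPairing ι R M N) (f : ι → ℤ) : Prop where
  add : ∀ {i j k : ι}, P.root k = P.root i + P.root j → f k = f i + f j
  opp : ∀ i : ι, f (P.reflectionPerm i i) = -f i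

/-- A symmetric set of roots that is closed under addition. -/
structure IsSubsystem (P : RootPairing ι R M N) (D : Set ι) : Prop where
  add : ∀ {i j k : ι}, P.root k = P.root i + P.root j → i ∈ D → j ∈ D → k ∈ D
  opp : ∀ {i : ι}, i ∈ D → P.reflectionPerm i i ∈ D

/-- A positive system in `D`: a subset that is closed under addition and contains exactly one of
each pair of opposite roots. -/
structure IsPositiveSystem (P : RootPairing ι R M N) (D Q : Set ι) : Prop where
  subset : Q ⊆ D
  add : ∀ {i j k : ι}, P.root k = P.root i + P.root j → i ∈ Q → j ∈ Q → k ∈ Q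
  opp_iff : ∀ {i : ι}, i ∈ D → (P.reflectionPerm i i ∈ Q ↔ i ∉ Q)

/-- The part of `D` on which `f` is positive. -/
def posPart (D : Set ι) (f : ι → ℤ) : Set ι := {i | i ∈ D ∧ 0 < f i}

/-- The indecomposable elements of `Q`. -/
def indec (P : RootPairing ι R M N) (Q : Set ι) : Set ι :=
  {i | i ∈ Q ∧ ∀ j ∈ Q, ∀ k ∈ Q, P.root i ≠ P.root j + P.root k}

/-- The subgroup of the Weyl group generated by the reflections in the elements of `S`. -/
def reflSubgroup (P : RootPairing ι R M N) (S : Set ι) : Subgroup P.weylGroup :=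
  Subgroup.closure (weylGroup.ofIdx P '' S)

variable {P : RootPairing ι R M N} {D Q : Set ι} {f : ι → ℤ}

theorem isSubsystem_univ : IsSubsystem P Set.univ := ⟨fun _ _ _ => trivial, fun _ => trivial⟩

theorem IsPositiveSystem.opp_notMem (hQ : IsPositiveSystem P D Q) {i : ι} (hi : i ∈ Q) :
    P.reflectionPerm i i ∉ Q := fun h => (hQ.opp_iff (hQ.subset hi)).1 h hi

theorem isPositiveSystem_posPart (hD : IsSubsystem P D) (hf : IsAdditive P f)
    (h0 : ∀ i ∈ D, f i ≠ 0) : IsPositiveSystem P D (posPart D f) where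
  subset := fun _ h => h.1
  add := fun h hi hj => ⟨hD.add h hi.1 hj.1, by rw [hf.add h]; exact add_pos hi.2 hj.2⟩
  opp_iff := fun {i} hi => by
    have := h0 i hi
    simp only [posPart, Set.mem_ofPred_eq, hi, hD.opp hi, hf.opp, true_and]
    lia

theorem ofIdx_mem_reflSubgroup {S : Set ι} {i : ι} (hi : i ∈ S) :
    weylGroup.ofIdx P i ∈ reflSubgroup P S := Subgroup.subset_closure ⟨i, hi, rfl⟩

/-- Induction on the elements of a positive system cut out by a functional: every element is
obtained from indecomposable ones by successive additions. -/
theorem posPart_induction (hf : IsAdditive P f) {p : ι → Prop}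
    (h1 : ∀ i ∈ indec P (posPart D f), p i)
    (h2 : ∀ i j k, i ∈ posPart D f → j ∈ posPart D f → k ∈ posPart D f →
      P.root k = P.root i + P.root j → p i → p j → p k) :
    ∀ i ∈ posPart D f, p i := by
  intro i hi
  generalize hn : (f i).toNat = n
  induction n using Nat.strong_induction_on generalizing i with
  | _ n ih =>
    by_cases hs : i ∈ indec P (posPart D f)
    · exact h1 i hs
    · have : ∃ j ∈ posPart D f, ∃ k ∈ posPart D f, P.root i = P.root j + P.root k := by
        by_contra! hcon
        exact hs ⟨hi, hcon⟩
      obtain ⟨j, hj, k, hk, h⟩ := this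
      have hadd := hf.add h
      have hj0 := hj.2
      have hk0 := hk.2
      exact h2 j k i hj hk hi h (ih _ (by lia) j hj rfl) (ih _ (by lia) k hk rfl)

variable [Finite ι] [IsDomain R] [CharZero R] [P.IsCrystallographic] [P.IsReduced]

/-- If `j` is a root, then so are all elements of the segment from `j` to `j - ⟨j, i⟩ i`. -/
theorem exists_root_sub_smul {i j : ι} (hij : j ≠ i) (hij' : j ≠ P.reflectionPerm i i) {n : ℤ}
    (hn : 0 ≤ n ∧ n ≤ P.pairingIn ℤ j i ∨ P.pairingIn ℤ j i ≤ n ∧ n ≤ 0) :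
    ∃ k, P.root k = P.root j - n • P.root i := by
  have hli : LinearIndependent R ![P.root i, P.root j] := by
    refine IsReduced.linearIndependent P hij.symm fun h => hij' ?_
    rw [eq_opp_iff, h, neg_neg]
  have h0 := (P.root_sub_zsmul_mem_range_iff hli (z := 0)).1 ⟨j, by simp⟩
  have h1 := (P.root_sub_zsmul_mem_range_iff hli (z := P.pairingIn ℤ j i)).1
    ⟨_, root_reflectionPerm_eq i j⟩
  refine (P.root_sub_zsmul_mem_range_iff hli (z := n)).2 ?_
  rw [Set.mem_Icc] at *
  lia

/-- To pass from `j` to its reflection one can move along the root string step by step. -/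
theorem reflectionPerm_induction {i j : ι} {p : ι → Prop} (hij : j ≠ i)
    (hij' : j ≠ P.reflectionPerm i i) (h0 : p j)
    (hadd : ∀ k l, P.root k = P.root l + P.root i → p l → p k)
    (hsub : ∀ k l, P.root l = P.root k + P.root i → p l → p k) : p (P.reflectionPerm i j) := by
  -- `n` counts steps along the string; the sign of the pairing is the direction of the walk.
  have hcore : ∀ n : ℕ, (n : ℤ) ≤ |P.pairingIn ℤ j i| → ∀ k,
      P.root k = P.root j - (n * (P.pairingIn ℤ j i).sign) • P.root i → p k := by
    intro n
    induction n with
    | zero =>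
      intro _ k hk
      have : k = j := P.root.injective (by simpa using hk)
      rwa [this]
    | succ n ih =>
      intro hn k hk
      rcases lt_trichotomy (P.pairingIn ℤ j i) 0 with h | h | h
      · obtain ⟨l, hl⟩ := exists_root_sub_smul hij hij' (n := n * (P.pairingIn ℤ j i).sign) (by
          rw [abs_of_neg h] at hn
          rw [Int.sign_eq_neg_one_of_neg h]
          lia)
        refine hadd k l ?_ (ih (by lia) l hl)
        rw [hk, hl, Int.sign_eq_neg_one_of_neg h]
        push_cast
        module
      · rw [h] at hn
        simp at hn
        lia
      · obtain ⟨l, hl⟩ := exists_root_sub_smul hij hij' (n := n * (P.pairingIn ℤ j i).sign) (by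
          rw [abs_of_pos h] at hn
          rw [Int.sign_eq_one_of_pos h]
          lia)
        refine hsub k l ?_ (ih (by lia) l hl)
        rw [hk, hl, Int.sign_eq_one_of_pos h]
        push_cast
        module
  refine hcore (P.pairingIn ℤ j i).natAbs (by simp) _ ?_
  rw [root_reflectionPerm_eq, mul_comm, Int.sign_mul_natAbs]

/-- The reflection in an indecomposable element `i` of a positive system `Q` permutes the
elements of `Q` other than `i`. -/
theorem IsPositiveSystem.reflectionPerm_mem (hQ : IsPositiveSystem P D Q) (hD : IsSubsystem P D)
    {i j : ι} (hi : i ∈ indec P Q) (hj : j ∈ Q) (hij : j ≠ i) : P.reflectionPerm i j ∈ Q := by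
  have hij' : j ≠ P.reflectionPerm i i := by
    rintro rfl
    exact hQ.opp_notMem hi.1 hj
  refine reflectionPerm_induction hij hij' hj (fun k l h hl => hQ.add h hl hi.1)
    fun k l h hl => ?_
  -- Otherwise `-k` lies in `Q`, and `i = l + (-k)` contradicts indecomposability.
  by_contra hkQ
  have hkD : k ∈ D := by
    refine hD.add (i := l) (j := P.reflectionPerm i i) ?_ (hQ.subset hl)
      (hD.opp (hQ.subset hi.1))
    rw [root_opp, h]
    module
  refine hi.2 l hl _ ((hQ.opp_iff hkD).2 hkQ) ?_
  rw [root_opp, h]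
  module

theorem IsSubsystem.reflectionPerm_mem (hD : IsSubsystem P D) {i j : ι} (hi : i ∈ D) (hj : j ∈ D) :
    P.reflectionPerm i j ∈ D := by
  rcases eq_or_ne j i with rfl | hij
  · exact hD.opp hi
  rcases eq_or_ne j (P.reflectionPerm i i) with rfl | hij'
  · rwa [reflectionPerm_self]
  refine reflectionPerm_induction hij hij' hj (fun k l h hl => hD.add h hl hi) fun k l h hl => ?_
  refine hD.add (i := l) (j := P.reflectionPerm i i) ?_ hl (hD.opp hi)
  rw [root_opp, h]
  module

theorem IsSubsystem.smul_mem (hD : IsSubsystem P D) {w : P.weylGroup}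
    (hw : w ∈ reflSubgroup P D) : ∀ {j : ι}, j ∈ D → w • j ∈ D := by
  induction hw using Subgroup.closure_induction'' with
  | one => intro j hj; rwa [one_smul]
  | mem x hx =>
    obtain ⟨i, hi, rfl⟩ := hx
    intro j hj
    exact hD.reflectionPerm_mem hi hj
  | inv_mem x hx =>
    obtain ⟨i, hi, rfl⟩ := hx
    intro j hj
    rw [ofIdx_inv]
    exact hD.reflectionPerm_mem hi hj
  | mul x y _ _ hx hy => intro j hj; rw [mul_smul]; exact hx (hy hj)

/-- Any two positive systems of `D` are conjugate under the subgroup generated by the reflections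
in the indecomposable elements of the first. -/
theorem exists_smul_mem_posPart_iff (hD : IsSubsystem P D) (hf : IsAdditive P f)
    (h0 : ∀ i ∈ D, f i ≠ 0) {Q : Set ι} (hQ : IsPositiveSystem P D Q) :
    ∃ w ∈ reflSubgroup P (indec P (posPart D f)),
      ∀ i ∈ D, (w • i ∈ posPart D f ↔ i ∈ Q) := by
  have hF := isPositiveSystem_posPart hD hf h0
  generalize hn : (posPart D f \ Q).ncard = n
  induction n using Nat.strong_induction_on generalizing Q with
  | _ n ih =>
    by_cases hs : ∃ i ∈ indec P (posPart D f), i ∉ Q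
    · obtain ⟨a, ha, haQ⟩ := hs
      have haD := hF.subset ha.1
      -- Replace `Q` by its reflection in `a`. This reflection permutes the positive elements other
      -- than `a`, and `a` itself is no longer missing, so fewer positive elements lie outside.
      have hQ' : IsPositiveSystem P D {i | i ∈ D ∧ P.reflectionPerm a i ∈ Q} := by
        refine ⟨fun i h => h.1, fun h hi hj => ⟨hD.add h hi.1 hj.1, ?_⟩, fun {i} hi => ?_⟩
        · refine hQ.add ?_ hi.2 hj.2
          exact smul_index_add (weylGroup.ofIdx P a) h
        · have h1 := hQ.opp_iff (hD.reflectionPerm_mem haD hi)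
          simp only [Set.mem_ofPred_eq, hD.opp hi, hi, true_and]
          rw [← h1]
          exact iff_of_eq (congrArg (· ∈ Q) (smul_opp (weylGroup.ofIdx P a) i))
      have hlt : (posPart D f \ {i | i ∈ D ∧ P.reflectionPerm a i ∈ Q}).ncard < n := by
        rw [← hn, ← Set.ncard_image_of_injective _ (P.reflectionPerm a).injective]
        refine Set.ncard_lt_ncard ?_ (Set.toFinite _)
        refine (Set.ssubset_iff_of_subset ?_).2 ⟨a, ⟨ha.1, haQ⟩, ?_⟩
        · rintro _ ⟨i, ⟨hi, hiQ⟩, rfl⟩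
          have hiQ' : P.reflectionPerm a i ∉ Q := fun h => hiQ ⟨hi.1, h⟩
          refine ⟨hF.reflectionPerm_mem hD ha hi ?_, hiQ'⟩
          rintro rfl
          exact hiQ' ((hQ.opp_iff haD).2 haQ)
        · rintro ⟨i, ⟨hi, -⟩, hia⟩
          have : i = P.reflectionPerm a a := by
            apply (P.reflectionPerm a).injective
            rw [reflectionPerm_self, hia]
          rw [this] at hi
          exact hF.opp_notMem ha.1 hi
      obtain ⟨w, hw, hwi⟩ := ih _ hlt hQ' rfl
      refine ⟨w * weylGroup.ofIdx P a, mul_mem hw (ofIdx_mem_reflSubgroup ha), fun i hi => ?_⟩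
      rw [mul_smul, ofIdx_smul_index, hwi _ (hD.reflectionPerm_mem haD hi), Set.mem_ofPred_eq,
        reflectionPerm_self]
      exact and_iff_right (hD.reflectionPerm_mem haD hi)
    · push Not at hs
      have hsub : posPart D f ⊆ Q :=
        posPart_induction hf hs fun i j k _ _ _ h hi hj => hQ.add h hi hj
      refine ⟨1, one_mem _, fun i hi => ?_⟩
      rw [one_smul]
      refine ⟨fun h => hsub h, fun h => ?_⟩
      by_contra hcon
      exact hQ.opp_notMem h (hsub ((hF.opp_iff hi).2 hcon))

variable [P.IsRootSystem]

/-- The reflections in the elements of `D` are products of reflections in indecomposable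
elements. -/
theorem reflSubgroup_le_indec (hD : IsSubsystem P D) (hf : IsAdditive P f)
    (h0 : ∀ i ∈ D, f i ≠ 0) :
    reflSubgroup P D ≤ reflSubgroup P (indec P (posPart D f)) := by
  have hF := isPositiveSystem_posPart hD hf h0
  have key : ∀ i ∈ posPart D f,
      weylGroup.ofIdx P i ∈ reflSubgroup P (indec P (posPart D f)) := by
    intro i hi
    generalize hn : (f i).toNat = n
    induction n using Nat.strong_induction_on generalizing i with
    | _ n ih =>
      -- If no indecomposable element paired positively with `i`, additivity of `⟨·, i⟩` would give
      -- `⟨i, i⟩ ≤ 0`. Reflecting in `a` then lowers `f`, and conjugation by `a` brings the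
      -- reflection in `i` back.
      obtain ⟨a, ha, hpos⟩ : ∃ a ∈ indec P (posPart D f), 0 < P.pairingIn ℤ a i := by
        by_contra! hcon
        have : P.pairingIn ℤ i i ≤ 0 :=
          posPart_induction (p := fun j => P.pairingIn ℤ j i ≤ 0) hf hcon
            (fun j k l _ _ _ h hj hk => by
              rw [pairingIn_eq_add_of_root_eq_add h]; exact add_nonpos hj hk) i hi
        simp at this
      rcases eq_or_ne i a with rfl | hia
      · exact ofIdx_mem_reflSubgroup ha
      have hmem := hF.reflectionPerm_mem hD ha hi hia
      have hlt : f (P.reflectionPerm a i) < f i := by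
        -- `f` is defined on roots only, so its value is followed one step at a time down the root
        -- string.
        have hdec : ∀ n : ℕ, (n : ℤ) ≤ P.pairingIn ℤ i a → ∀ k,
            P.root k = P.root i - (n : ℤ) • P.root a → f k = f i - n * f a := by
          intro n
          induction n with
          | zero =>
            intro _ k hk
            have : k = i := P.root.injective (by simpa using hk)
            simp [this]
          | succ n ihn =>
            intro hn k hk
            obtain ⟨l, hl⟩ := exists_root_sub_smul hia
              (fun h => hF.opp_notMem ha.1 (h ▸ hi)) (n := n) (by lia)
            have h1 := ihn (by lia) l hl
            have h2 : P.root l = P.root k + P.root a := by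
              rw [hk, hl]; push_cast; module
            have h3 := hf.add h2
            push_cast
            linarith
        have hpos' := (P.zero_lt_pairingIn_iff' ℤ).1 hpos
        have h1 := hdec (P.pairingIn ℤ i a).toNat (by lia) (P.reflectionPerm a i) (by
          rw [root_reflectionPerm_eq, Int.toNat_of_nonneg hpos'.le])
        rw [Int.toNat_of_nonneg hpos'.le] at h1
        have := mul_pos hpos' ha.1.2
        lia
      have h2 := ih _ (by have := hi.2; lia) _ hmem rfl
      have h3 : weylGroup.ofIdx P i = weylGroup.ofIdx P a *
          weylGroup.ofIdx P (P.reflectionPerm a i) * (weylGroup.ofIdx P a)⁻¹ := by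
        rw [conj_ofIdx, ofIdx_smul_index, reflectionPerm_self]
      rw [h3]
      exact mul_mem (mul_mem (ofIdx_mem_reflSubgroup ha) h2)
        (inv_mem (ofIdx_mem_reflSubgroup ha))
  refine (Subgroup.closure_le _).2 ?_
  rintro _ ⟨i, hi, rfl⟩
  by_cases hiF : i ∈ posPart D f
  · exact key i hiF
  · rw [← ofIdx_opp]
    exact key _ ((hF.opp_iff hi).2 hiF)

/-- The exchange condition. -/
theorem exists_exchange {Q : Set ι} (hQ : IsPositiveSystem P D Q) (hD : IsSubsystem P D)
    {a : ι} (ha : a ∈ Q) (l : List ι) (hl : ∀ i ∈ l, i ∈ indec P Q)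
    (hneg : (l.map (weylGroup.ofIdx P)).prod • a ∉ Q) :
    ∃ l' : List ι, l'.length + 1 = l.length ∧ (∀ i ∈ l', i ∈ indec P Q) ∧
      (l'.map (weylGroup.ofIdx P)).prod =
        (l.map (weylGroup.ofIdx P)).prod * weylGroup.ofIdx P a := by
  induction l with
  | nil => simp [ha] at hneg
  | cons c l ih =>
    have hl' : ∀ i ∈ l, i ∈ indec P Q := fun i hi => hl i (List.mem_cons_of_mem _ hi)
    have hc : c ∈ indec P Q := hl c List.mem_cons_self
    by_cases h : (l.map (weylGroup.ofIdx P)).prod • a ∈ Q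
    · refine ⟨l, rfl, hl', ?_⟩
      -- Within `Q`, the reflection in `c` makes only `c` negative. So the remaining word sends `a`
      -- to `c`, and conjugating by it turns the reflection in `a` into the deleted letter.
      have hac : (l.map (weylGroup.ofIdx P)).prod • a = c := by
        by_contra hne
        apply hneg
        rw [List.map_cons, List.prod_cons, mul_smul]
        exact hQ.reflectionPerm_mem hD hc h hne
      have h1 := conj_ofIdx (l.map (weylGroup.ofIdx P)).prod a
      rw [hac, mul_inv_eq_iff_eq_mul] at h1
      rw [List.map_cons, List.prod_cons, mul_assoc, h1, ← mul_assoc, ofIdx_mul_self, one_mul]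
    · obtain ⟨l', hlen, hl'', hprod⟩ := ih hl' h
      refine ⟨c :: l', by simp [hlen], ?_, ?_⟩
      · intro i hi
        rcases List.mem_cons.1 hi with rfl | hi
        · exact hc
        · exact hl'' i hi
      · rw [List.map_cons, List.prod_cons, hprod, List.map_cons, List.prod_cons, mul_assoc]

/-- An element of the Weyl group of `D` that preserves a positive system is trivial. -/
theorem eq_one_of_smul_mem_posPart (hD : IsSubsystem P D) (hf : IsAdditive P f)
    (h0 : ∀ i ∈ D, f i ≠ 0) {w : P.weylGroup} (hw : w ∈ reflSubgroup P D)
    (h : ∀ i ∈ posPart D f, w • i ∈ posPart D f) : w = 1 := by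
  have hF := isPositiveSystem_posPart hD hf h0
  have hrep : ∃ l : List ι, (∀ i ∈ l, i ∈ indec P (posPart D f)) ∧
      (l.map (weylGroup.ofIdx P)).prod = w := by
    have hw' := reflSubgroup_le_indec hD hf h0 hw
    clear h hw
    induction hw' using Subgroup.closure_induction'' with
    | one => exact ⟨[], by simp, by simp⟩
    | mem x hx =>
      obtain ⟨i, hi, rfl⟩ := hx
      exact ⟨[i], by simpa using hi, by simp⟩
    | inv_mem x hx =>
      obtain ⟨i, hi, rfl⟩ := hx
      exact ⟨[i], by simpa using hi, by simp [ofIdx_inv]⟩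
    | mul x y _ _ hx hy =>
      obtain ⟨l, hl, rfl⟩ := hx
      obtain ⟨l', hl', rfl⟩ := hy
      refine ⟨l ++ l', fun i hi => ?_, by simp⟩
      rcases List.mem_append.1 hi with hi | hi
      · exact hl i hi
      · exact hl' i hi
  obtain ⟨l, hl, rfl⟩ := hrep
  clear hw
  generalize hn : l.length = n
  induction n using Nat.strong_induction_on generalizing l with
  | _ n ih =>
    rcases List.eq_nil_or_concat l with rfl | ⟨l, a, rfl⟩
    · simp
    · have ha : a ∈ indec P (posPart D f) := hl a (by simp)
      have hl1 : ∀ i ∈ l, i ∈ indec P (posPart D f) := fun i hi => hl i (by simp [hi])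
      have hprod : ((l.concat a).map (weylGroup.ofIdx P)).prod =
          (l.map (weylGroup.ofIdx P)).prod * weylGroup.ofIdx P a := by simp
      -- The full word keeps `a` positive and its last letter negates `a`, so the shorter word makes
      -- `a` negative. Exchange then rewrites the full word with two letters fewer.
      have hneg : (l.map (weylGroup.ofIdx P)).prod • a ∉ posPart D f := by
        intro hcon
        have h1 := h a ha.1
        rw [hprod, mul_smul, ofIdx_smul_index, smul_opp] at h1
        exact hF.opp_notMem hcon h1
      obtain ⟨l', hlen, hl', hp⟩ := exists_exchange hF hD ha.1 l hl1 hneg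
      rw [hprod, ← hp]
      rw [hprod, ← hp] at h
      refine ih l'.length ?_ l' hl' h rfl
      rw [← hn, List.length_concat]
      lia

/-- The elements of the Weyl group that map a positive system of `D` into a positive system of the
whole root system are coset representatives for the Weyl group of `D`. -/
theorem encard_minimal_representatives (hD : IsSubsystem P D) (hf : IsAdditive P f)
    (h0 : ∀ i ∈ D, f i ≠ 0) {g : ι → ℤ} (hg : IsAdditive P g) (hg0 : ∀ i, g i ≠ 0) :
    {w : P.weylGroup | ∀ i ∈ posPart D f, 0 < g (w • i)}.encard =
      ((reflSubgroup P D).index : ℕ∞) := by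
  have hF := isPositiveSystem_posPart hD hf h0
  have hbij : Set.BijOn (fun w : P.weylGroup => (w : P.weylGroup ⧸ reflSubgroup P D))
      {w : P.weylGroup | ∀ i ∈ posPart D f, 0 < g (w • i)} Set.univ := by
    refine ⟨fun _ _ => trivial, ?_, ?_⟩
    · intro v hv w hw hvw
      have hu : v⁻¹ * w ∈ reflSubgroup P D := QuotientGroup.eq.1 hvw
      have h1 : v⁻¹ * w = 1 := by
        -- With `u = v⁻¹ w`: if `u i` were not positive, `v` would make `-u i` positive, that is, `w
        -- i` would be negative.
        refine eq_one_of_smul_mem_posPart hD hf h0 hu fun i hi => ?_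
        by_contra hcon
        have hiD := hD.smul_mem hu hi.1
        have h2 := hv _ ((hF.opp_iff hiD).2 hcon)
        have h3 := hw i hi
        rw [smul_opp, hg.opp, mul_smul, smul_inv_smul] at h2
        lia
      exact inv_mul_eq_one.1 h1
    · intro c _
      obtain ⟨v, rfl⟩ := QuotientGroup.mk_surjective c
      -- The part of `D` that `v` makes positive is conjugate to `posPart D f` by some `u` in the
      -- subgroup; `v u⁻¹` is then the representative sought.
      have hQ : IsPositiveSystem P D {i | i ∈ D ∧ 0 < g (v • i)} := by
        refine ⟨fun i h => h.1, fun h hi hj => ⟨hD.add h hi.1 hj.1, ?_⟩, fun {i} hi => ?_⟩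
        · rw [hg.add (smul_index_add v h)]
          exact add_pos hi.2 hj.2
        · have := hg0 (v • i)
          simp only [Set.mem_ofPred_eq, hD.opp hi, hi, true_and, smul_opp, hg.opp]
          lia
      obtain ⟨u, hu, hui⟩ := exists_smul_mem_posPart_iff hD hf h0 hQ
      have hu' : u ∈ reflSubgroup P D :=
        Subgroup.closure_mono (Set.image_mono fun i hi => hi.1.1) hu
      refine ⟨v * u⁻¹, fun i hi => ?_, ?_⟩
      · have hiD := hD.smul_mem (inv_mem hu') hi.1
        have h1 := (hui _ hiD).1 (by rwa [smul_inv_smul])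
        rw [mul_smul]
        exact h1.2
      · refine QuotientGroup.eq.2 ?_
        rw [mul_inv_rev, inv_inv, mul_assoc, inv_mul_cancel, mul_one]
        exact hu'
  rw [← hbij.injOn.encard_image, hbij.image_eq, Set.encard_univ, ENat.card_eq_coe_natCard]
  rfl

end PositiveSystems

/-! ### Weyl group elements and stable sets of level-one roots. -/

section Levels

variable {ι R M N : Type*} [CommRing R] [AddCommGroup M] [Module R M] [AddCommGroup N] [Module R N]

/-! ### Gradings of height two

`g` is a functional defining the positive roots (such as the height), and `l` is a functional with
values `0`, `1`, `2` on the positive roots, the level. -/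

/-- A grading `l` of the roots that takes the values `0`, `1`, `2` on the positive roots. -/
structure IsGrading (P : RootPairing ι R M N) (g l : ι → ℤ) : Prop where
  pos_additive : IsAdditive P g
  pos_ne_zero : ∀ i, g i ≠ 0
  additive : IsAdditive P l
  nonneg : ∀ i, 0 < g i → 0 ≤ l i
  le_two : ∀ i, l i ≤ 2

/-- The sets of roots of level one that are stable under adding positive roots of level zero. -/
def stableSets (P : RootPairing ι R M N) (g l : ι → ℤ) : Set (Set ι) :=
  {Φ | (∀ i ∈ Φ, l i = 1) ∧
    ∀ i j k, P.root k = P.root i + P.root j → i ∈ Φ → l j = 0 → 0 < g j → k ∈ Φ}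

/-- The roots that are sums of two elements of `Φ`. -/
def rootSums (P : RootPairing ι R M N) (Φ : Set ι) : Set ι :=
  {k | ∃ i ∈ Φ, ∃ j ∈ Φ, P.root k = P.root i + P.root j}

/-- The elements of the Weyl group that preserve the positivity of the roots of level zero. -/
def levelReps (P : RootPairing ι R M N) (g l : ι → ℤ) : Set P.weylGroup :=
  {v | ∀ i, l i = 0 → 0 < g i → 0 < g (v • i)}

/-- The elements of `levelReps` that map no root of level two to a simple root. -/
def hatReps (P : RootPairing ι R M N) (g l : ι → ℤ) : Set P.weylGroup :=
  {v | v ∈ levelReps P g l ∧ ∀ i, l i = 2 → v • i ∉ indec P (posPart Set.univ g)}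

/-- The elements of `levelReps` that map all roots of level two to negative roots. -/
def abReps (P : RootPairing ι R M N) (g l : ι → ℤ) : Set P.weylGroup :=
  {v | v ∈ levelReps P g l ∧ ∀ i, l i = 2 → ¬ 0 < g (v • i)}

/-- The roots of level one that `v` maps to positive roots. -/
def levelOne (g l : ι → ℤ) {P : RootPairing ι R M N} (v : P.weylGroup) : Set ι :=
  {i | l i = 1 ∧ 0 < g (v • i)}

variable {P : RootPairing ι R M N} {g l : ι → ℤ} {Φ : Set ι}

theorem mem_posPart_univ {i : ι} : i ∈ posPart Set.univ g ↔ 0 < g i := by simp [posPart]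

theorem IsAdditive.eq_neg (hg : IsAdditive P g) {i j : ι} (h : P.root i = -P.root j) :
    g i = -g j := by
  rw [← hg.opp, ← eq_opp_iff.2 h]

theorem IsGrading.neg_two_le (h : IsGrading P g l) (i : ι) : -2 ≤ l i := by
  have h1 := h.le_two (P.reflectionPerm i i)
  rw [h.additive.opp] at h1
  lia

theorem abReps_subset_hatReps : abReps P g l ⊆ hatReps P g l :=
  fun _ hv => ⟨hv.1, fun i hi hmem => hv.2 i hi (mem_posPart_univ.1 hmem.1)⟩

theorem level_of_mem_rootSums (h : IsGrading P g l) (hΦ : Φ ∈ stableSets P g l) {k : ι}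
    (hk : k ∈ rootSums P Φ) : l k = 2 := by
  obtain ⟨i, hi, j, hj, hk⟩ := hk
  rw [h.additive.add hk, hΦ.1 i hi, hΦ.1 j hj]
  rfl

theorem levelOne_mem_stableSets (h : IsGrading P g l) {v : P.weylGroup}
    (hv : v ∈ levelReps P g l) : levelOne g l v ∈ stableSets P g l := by
  refine ⟨fun i hi => hi.1, fun i j k hk hi hj hj' => ⟨?_, ?_⟩⟩
  · rw [h.additive.add hk, hi.1, hj]; rfl
  · rw [h.pos_additive.add (smul_index_add v hk)]
    exact add_pos hi.2 (hv j hj hj')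

theorem IsGrading.pos_smul_opp_iff (h : IsGrading P g l) (v : P.weylGroup) (i : ι) :
    0 < g (v • P.reflectionPerm i i) ↔ ¬ 0 < g (v • i) := by
  have := h.pos_ne_zero (v • i)
  rw [smul_opp, h.pos_additive.opp]
  lia

theorem pos_smul_iff_of_level_zero (h : IsGrading P g l) {v : P.weylGroup}
    (hv : v ∈ levelReps P g l) {i : ι} (hi : l i = 0) : 0 < g (v • i) ↔ 0 < g i := by
  refine ⟨fun hpos => ?_, hv i hi⟩
  by_contra hneg
  have h0 := h.pos_ne_zero i
  have h1 := hv (P.reflectionPerm i i) (by rw [h.additive.opp, hi]; rfl)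
    (by rw [h.pos_additive.opp]; lia)
  exact (h.pos_smul_opp_iff v i).1 h1 hpos

theorem mem_rootSums_of_pos_smul (h : IsGrading P g l) {v : P.weylGroup} {i : ι} (hi : i ∈ rootSums P (levelOne g l v)) :
    l i = 2 ∧ 0 < g (v • i) := by
  obtain ⟨p, hp, q, hq, hpq⟩ := hi
  refine ⟨?_, ?_⟩
  · rw [h.additive.add hpq, hp.1, hq.1]; rfl
  · rw [h.pos_additive.add (smul_index_add v hpq)]
    exact add_pos hp.2 hq.2

theorem mem_reflSubgroup_univ (w : P.weylGroup) : w ∈ reflSubgroup P Set.univ := by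
  obtain ⟨w, hw⟩ := w
  induction hw using weylGroup.induction with
  | mem i => exact ofIdx_mem_reflSubgroup (Set.mem_univ i)
  | one => exact one_mem _
  | mul x y hx hy h1 h2 => exact mul_mem h1 h2

/-- Positivity with respect to the positive system of `exists_hatReps`, for roots of nonnegative
level. -/
def levelPos (P : RootPairing ι R M N) (g l : ι → ℤ) (Φ : Set ι) (i : ι) : Prop :=
  (l i = 0 ∧ 0 < g i) ∨ i ∈ Φ ∨ i ∈ rootSums P Φ

theorem levelPos_zero (h : IsGrading P g l) (hΦ : Φ ∈ stableSets P g l) {i : ι} (hi : l i = 0) :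
    levelPos P g l Φ i ↔ 0 < g i := by
  refine ⟨?_, fun hp => Or.inl ⟨hi, hp⟩⟩
  rintro (hp | hp | hp)
  · exact hp.2
  · have := hΦ.1 i hp
    lia
  · have := level_of_mem_rootSums h hΦ hp
    lia

theorem levelPos_one (h : IsGrading P g l) (hΦ : Φ ∈ stableSets P g l) {i : ι} (hi : l i = 1) :
    levelPos P g l Φ i ↔ i ∈ Φ := by
  refine ⟨?_, fun hp => Or.inr (Or.inl hp)⟩
  rintro (hp | hp | hp)
  · lia
  · exact hp
  · have := level_of_mem_rootSums h hΦ hp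
    lia

theorem levelPos_two (hΦ : Φ ∈ stableSets P g l) {i : ι} (hi : l i = 2) :
    levelPos P g l Φ i ↔ i ∈ rootSums P Φ := by
  refine ⟨?_, fun hp => Or.inr (Or.inr hp)⟩
  rintro (hp | hp | hp)
  · lia
  · have := hΦ.1 i hp
    lia
  · exact hp

variable [Finite ι] [IsDomain R] [CharZero R] [P.IsCrystallographic]

/-- In `p + q + j`, the root `j` can be absorbed into `p` or into `q`, and stability keeps the
result in `Φ`. The levels rule out `j = -p` and `j = -q`. -/
theorem add_mem_rootSums (h : IsGrading P g l) (hΦ : Φ ∈ stableSets P g l) {a j k : ι}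
    (ha : a ∈ rootSums P Φ) (hj : l j = 0) (hj' : 0 < g j) (hk : P.root k = P.root a + P.root j) :
    k ∈ rootSums P Φ := by
  obtain ⟨p, hp, q, hq, hpq⟩ := ha
  have hne : ∀ r ∈ Φ, P.root j ≠ -P.root r := fun r hr hjr => by
    have := h.additive.eq_neg hjr
    rw [hj, hΦ.1 r hr] at this
    lia
  rcases add_mem_or_of_add_add hpq hk (hne p hp) (hne q hq) with ⟨m, hm⟩ | ⟨m, hm⟩
  · exact ⟨m, hΦ.2 p j m hm hp hj hj', q, hq, by rw [hk, hpq, hm]; module⟩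
  · exact ⟨p, hp, m, hΦ.2 q j m hm hq hj hj', by rw [hk, hpq, hm]; module⟩

/-- Induction on the value of `g` at `v • i`. As `v • i` is not simple, `i` is a sum of two roots
made positive by `v`. No level exceeds two, so the summands have levels 1 and 1, which is the claim,
or 0 and 2, where induction and `add_mem_rootSums` apply. -/
theorem pos_smul_iff_mem_rootSums (h : IsGrading P g l) {v : P.weylGroup}
    (hv : v ∈ hatReps P g l) {i : ι} (hi : l i = 2) :
    0 < g (v • i) ↔ i ∈ rootSums P (levelOne g l v) := by
  refine ⟨fun hpos => ?_, fun hmem => (mem_rootSums_of_pos_smul h hmem).2⟩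
  generalize hn : (g (v • i)).toNat = n
  induction n using Nat.strong_induction_on generalizing i with
  | _ n ih =>
    obtain ⟨a, ha, b, hb, hab⟩ : ∃ a, 0 < g (v • a) ∧ ∃ b, 0 < g (v • b) ∧
        P.root i = P.root a + P.root b := by
      by_contra! hcon
      refine hv.2 i hi ⟨mem_posPart_univ.2 hpos, fun j hj k hk hjk => ?_⟩
      refine hcon (v⁻¹ • j) (by rw [smul_inv_smul]; exact hj.2) (v⁻¹ • k)
        (by rw [smul_inv_smul]; exact hk.2) ?_
      rw [← smul_index_add v⁻¹ hjk, inv_smul_smul]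
    have hga := h.pos_additive.add (smul_index_add v hab)
    have hla := h.additive.add hab
    have key : ∀ a b, 0 < g (v • a) → 0 < g (v • b) → P.root i = P.root a + P.root b →
        l b = 0 → i ∈ rootSums P (levelOne g l v) := by
      intro a b ha hb hab hb0
      have hga := h.pos_additive.add (smul_index_add v hab)
      have hla := h.additive.add hab
      exact add_mem_rootSums h (levelOne_mem_stableSets h hv.1)
        (ih _ (by lia) (by lia) ha rfl) hb0 ((pos_smul_iff_of_level_zero h hv.1 hb0).1 hb) hab
    have h1 := h.le_two a
    have h2 := h.le_two b
    have h3 : l b = 0 ∨ l a = 0 ∨ l a = 1 ∧ l b = 1 := by lia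
    rcases h3 with h3 | h3 | h3
    · exact key a b ha hb hab h3
    · exact key b a hb ha (by rw [hab, add_comm]) h3
    · exact ⟨a, ⟨h3.1, ha⟩, b, ⟨h3.2, hb⟩, hab⟩

/-- Closure of the complement is needed as well as closure of the set: a root of negative level will
be declared positive when its opposite is not `levelPos`. -/
theorem levelPos_add (h : IsGrading P g l) (hΦ : Φ ∈ stableSets P g l) {a b c : ι}
    (ha0 : 0 ≤ l a) (hb0 : 0 ≤ l b) (hc : P.root c = P.root a + P.root b) :
    (levelPos P g l Φ a → levelPos P g l Φ b → levelPos P g l Φ c) ∧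
    (¬ levelPos P g l Φ a → ¬ levelPos P g l Φ b → ¬ levelPos P g l Φ c) := by
  wlog hab : l a ≤ l b generalizing a b with H
  · obtain ⟨h1, h2⟩ := H hb0 ha0 (by rw [hc, add_comm]) (by lia)
    exact ⟨fun x y => h1 y x, fun x y => h2 y x⟩
  have hlc := h.additive.add hc
  have hgc := h.pos_additive.add hc
  have hc2 := h.le_two c
  have hga := h.pos_ne_zero a
  have hgb := h.pos_ne_zero b
  have hoa : l (P.reflectionPerm a a) = -l a := h.additive.opp a
  have hob : g (P.reflectionPerm a a) = -g a := h.pos_additive.opp a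
  have hb' : P.root b = P.root c + P.root (P.reflectionPerm a a) := by
    rw [root_opp, hc]; module
  have hcases : (l a = 0 ∧ l b = 0) ∨ (l a = 0 ∧ l b = 1) ∨ (l a = 0 ∧ l b = 2) ∨
    (l a = 1 ∧ l b = 1) := by lia
  rcases hcases with ⟨ha, hb⟩ | ⟨ha, hb⟩ | ⟨ha, hb⟩ | ⟨ha, hb⟩
  · rw [levelPos_zero h hΦ ha, levelPos_zero h hΦ hb, levelPos_zero h hΦ (by lia : l c = 0)]
    constructor <;> intros <;> lia
  · rw [levelPos_zero h hΦ ha, levelPos_one h hΦ hb, levelPos_one h hΦ (by lia : l c = 1)]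
    refine ⟨fun x y => hΦ.2 b a c (by rw [hc, add_comm]) y ha x, fun x y z => y ?_⟩
    exact hΦ.2 c _ b hb' z (by lia) (by lia)
  · rw [levelPos_zero h hΦ ha, levelPos_two hΦ hb, levelPos_two hΦ (by lia : l c = 2)]
    refine ⟨fun x y => add_mem_rootSums h hΦ y ha x (by rw [hc, add_comm]), fun x y z => y ?_⟩
    exact add_mem_rootSums h hΦ z (by lia) (by lia) hb'
  · rw [levelPos_one h hΦ ha, levelPos_one h hΦ hb, levelPos_two hΦ (by lia : l c = 2)]
    refine ⟨fun x y => ⟨a, x, b, y, hc⟩, ?_⟩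
    rintro x y ⟨p, hp, q, hq, hpq⟩
    have hne : ∀ r ∈ Φ, P.root (P.reflectionPerm a a) ≠ -P.root r := fun r hr har => by
      rw [root_opp, neg_inj, P.root.injective.eq_iff] at har
      exact x (har ▸ hr)
    -- The critical case: `a + b = p + q` with `p, q ∈ Φ` and `a, b ∉ Φ`. If `m = p - a` is a root,
    -- it has level zero. When it is positive, `b = q + m` lies in `Φ`; when it is negative, `a = p
    -- + (-m)` does.
    have hcon : ∀ p ∈ Φ, ∀ q ∈ Φ, P.root c = P.root p + P.root q → ∀ m,
        P.root m = P.root p + P.root (P.reflectionPerm a a) → False := by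
      intro p hp q hq hpq m hm
      have hm0 : l m = 0 := by
        have := h.additive.add hm
        rw [hΦ.1 p hp] at this
        lia
      by_cases hgm : 0 < g m
      · exact y (hΦ.2 q m b (by rw [hb', hm, hpq]; module) hq hm0 hgm)
      · have hgm0 := h.pos_ne_zero m
        refine x (hΦ.2 p (P.reflectionPerm m m) a ?_ hp (by rw [h.additive.opp, hm0]; rfl)
          (by rw [h.pos_additive.opp]; lia))
        rw [root_opp, hm, root_opp]
        module
    rcases add_mem_or_of_add_add hpq hb' (hne p hp) (hne q hq) with ⟨m, hm⟩ | ⟨m, hm⟩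
    · exact hcon p hp q hq hpq m hm
    · exact hcon q hq p hp (by rw [hpq, add_comm]) m hm

theorem isPositiveSystem_levelPos (h : IsGrading P g l) (hΦ : Φ ∈ stableSets P g l) :
    IsPositiveSystem P Set.univ {i | (0 ≤ l i ∧ levelPos P g l Φ i) ∨
      (l i < 0 ∧ ¬ levelPos P g l Φ (P.reflectionPerm i i))} := by
  have hopp : ∀ i, l (P.reflectionPerm i i) = -l i := h.additive.opp
  refine ⟨fun _ _ => trivial, fun {i j k} hk hi hj => ?_, fun {i} _ => ?_⟩
  · have hlk := h.additive.add hk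
    -- For summands of levels of different sign, `k = i + j` is rewritten with nonnegative levels
    -- only: as `i = k + (-j)` or as `-j = i + (-k)`.
    have mixed : ∀ i j : ι, P.root k = P.root i + P.root j → 0 ≤ l i → l j < 0 →
        levelPos P g l Φ i → ¬ levelPos P g l Φ (P.reflectionPerm j j) →
        (0 ≤ l k ∧ levelPos P g l Φ k) ∨
          (l k < 0 ∧ ¬ levelPos P g l Φ (P.reflectionPerm k k)) := by
      intro i j hk hi hj hip hjp
      have hjo := hopp j
      have hko := hopp k
      rcases le_or_gt 0 (l k) with hk0 | hk0
      · refine Or.inl ⟨hk0, ?_⟩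
        by_contra hcon
        refine (levelPos_add h hΦ (a := k) (b := P.reflectionPerm j j) (c := i) hk0 (by lia)
          ?_).2 hcon hjp hip
        rw [root_opp, hk]; module
      · refine Or.inr ⟨hk0, fun hcon => hjp ?_⟩
        refine (levelPos_add h hΦ (a := i) (b := P.reflectionPerm k k) hi (by lia) ?_).1 hip hcon
        rw [root_opp, root_opp, hk]; module
    rcases hi with ⟨hi, hi'⟩ | ⟨hi, hi'⟩ <;> rcases hj with ⟨hj, hj'⟩ | ⟨hj, hj'⟩
    · exact Or.inl ⟨by lia, (levelPos_add h hΦ hi hj hk).1 hi' hj'⟩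
    · exact mixed i j hk hi hj hi' hj'
    · exact mixed j i (by rw [hk, add_comm]) hj hi hj' hi'
    · have hio := hopp i
      have hjo := hopp j
      refine Or.inr ⟨by lia, (levelPos_add h hΦ (a := P.reflectionPerm i i)
        (b := P.reflectionPerm j j) (by lia) (by lia) ?_).2 hi' hj'⟩
      rw [root_opp, root_opp, root_opp, hk]; module
  · have hio := hopp i
    simp only [Set.mem_ofPred_eq, opp_opp]
    rcases lt_trichotomy (l i) 0 with hi | hi | hi
    · simp [hi, not_le.2 hi, show 0 ≤ l (P.reflectionPerm i i) by lia,
        show ¬ l (P.reflectionPerm i i) < 0 by lia]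
    · have hio' : l (P.reflectionPerm i i) = 0 := by lia
      have := h.pos_ne_zero i
      simp only [hi, hio', levelPos_zero h hΦ hi, levelPos_zero h hΦ hio', h.pos_additive.opp,
        le_refl, lt_irrefl, true_and, false_and, or_false]
      lia
    · simp [hi.le, not_lt.2 hi.le, show ¬ 0 ≤ l (P.reflectionPerm i i) by lia,
        show l (P.reflectionPerm i i) < 0 by lia]

variable [P.IsReduced]

/-- The element `v` carries the positive system built from `Φ` to the standard one. A level-two root
it makes positive is a sum of two elements of `Φ`, so its image decomposes and is not simple. -/
theorem exists_hatReps (h : IsGrading P g l) (hΦ : Φ ∈ stableSets P g l) :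
    ∃ v ∈ hatReps P g l, levelOne g l v = Φ := by
  obtain ⟨v, -, hv⟩ := exists_smul_mem_posPart_iff isSubsystem_univ h.pos_additive
    (fun i _ => h.pos_ne_zero i) (isPositiveSystem_levelPos h hΦ)
  replace hv := fun i => hv i trivial
  simp only [mem_posPart_univ, Set.mem_ofPred_eq] at hv
  refine ⟨v, ⟨fun i hi hi' => (hv i).2 (Or.inl ⟨hi.ge, Or.inl ⟨hi, hi'⟩⟩), fun i hi hmem => ?_⟩, ?_⟩
  · obtain ⟨p, hp, q, hq, hpq⟩ : i ∈ rootSums P Φ := by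
      rcases (hv i).1 (mem_posPart_univ.1 hmem.1) with hp | hp
      · exact (levelPos_two hΦ hi).1 hp.2
      · lia
    have hpos : ∀ r ∈ Φ, v • r ∈ posPart Set.univ g := fun r hr =>
      mem_posPart_univ.2 ((hv r).2 (Or.inl ⟨by rw [hΦ.1 r hr]; exact zero_le_one,
        Or.inr (Or.inl hr)⟩))
    exact hmem.2 _ (hpos p hp) _ (hpos q hq) (smul_index_add v hpq)
  · ext i
    simp only [levelOne, Set.mem_ofPred_eq, hv]
    constructor
    · rintro ⟨hi, hp | hp⟩
      · exact (levelPos_one h hΦ hi).1 hp.2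
      · lia
    · intro hi
      have hi1 := hΦ.1 i hi
      exact ⟨hi1, Or.inl ⟨by lia, Or.inr (Or.inl hi)⟩⟩

variable [P.IsRootSystem]

/-- An element of the Weyl group is determined by the set of roots that it makes positive. -/
theorem eq_of_pos_smul_imp (hg : IsAdditive P g) (hg0 : ∀ i, g i ≠ 0) {v w : P.weylGroup}
    (hvw : ∀ i, 0 < g (v • i) → 0 < g (w • i)) : v = w := by
  have h1 : w * v⁻¹ = 1 := by
    refine eq_one_of_smul_mem_posPart isSubsystem_univ hg (fun i _ => hg0 i)
      (mem_reflSubgroup_univ _) fun i hi => ?_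
    rw [mem_posPart_univ] at hi ⊢
    rw [mul_smul]
    exact hvw _ (by rwa [smul_inv_smul])
  exact (mul_inv_eq_one.1 h1).symm

/-- Injectivity: positivity under `v` is fixed on level 0 by definition, on level 1 by the set
itself, on level 2 by its sums, and on negative levels by passing to opposites. -/
theorem bijOn_levelOne_hatReps (h : IsGrading P g l) :
    Set.BijOn (levelOne g l) (hatReps P g l) (stableSets P g l) := by
  refine ⟨fun v hv => levelOne_mem_stableSets h hv.1, ?_, fun Φ hΦ => exists_hatReps h hΦ⟩
  intro v hv w hw hvw
  have key : ∀ i, 0 ≤ l i → (0 < g (v • i) ↔ 0 < g (w • i)) := by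
    intro i hi
    have h2 := h.le_two i
    have hcases : l i = 0 ∨ l i = 1 ∨ l i = 2 := by lia
    rcases hcases with hi | hi | hi
    · rw [pos_smul_iff_of_level_zero h hv.1 hi, pos_smul_iff_of_level_zero h hw.1 hi]
    · have h3 := Set.ext_iff.1 hvw i
      simpa [levelOne, hi] using h3
    · rw [pos_smul_iff_mem_rootSums h hv hi, pos_smul_iff_mem_rootSums h hw hi, hvw]
  refine eq_of_pos_smul_imp h.pos_additive h.pos_ne_zero fun i hi => ?_
  rcases le_or_gt 0 (l i) with hi0 | hi0
  · exact (key i hi0).1 hi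
  · have h1 := key (P.reflectionPerm i i) (by rw [h.additive.opp]; lia)
    rw [h.pos_smul_opp_iff, h.pos_smul_opp_iff] at h1
    by_contra hcon
    exact h1.2 hcon hi

theorem bijOn_levelOne_abReps (h : IsGrading P g l) :
    Set.BijOn (levelOne g l) (abReps P g l) {Φ | Φ ∈ stableSets P g l ∧ rootSums P Φ = ∅} := by
  refine ⟨fun v hv => ⟨levelOne_mem_stableSets h hv.1, ?_⟩,
    (bijOn_levelOne_hatReps h).injOn.mono abReps_subset_hatReps, fun Φ hΦ => ?_⟩
  · refine Set.eq_empty_of_forall_notMem fun i hi => ?_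
    have h1 := mem_rootSums_of_pos_smul h hi
    exact hv.2 i h1.1 h1.2
  · obtain ⟨v, hv, rfl⟩ := exists_hatReps h hΦ.1
    refine ⟨v, ⟨hv.1, fun i hi hpos => ?_⟩, rfl⟩
    have h1 := (pos_smul_iff_mem_rootSums h hv hi).1 hpos
    rw [hΦ.2] at h1
    exact h1

/-- The even-level roots have a positive system made of the positive roots of level 0 and all roots
of level -2. The elements of `abReps` are those mapping it to positive roots, so they represent the
cosets. -/
theorem encard_abReps (h : IsGrading P g l) :
    (abReps P g l).encard = ((reflSubgroup P {i | Even (l i)}).index : ℕ∞) := by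
  obtain ⟨B, hB⟩ : ∃ B : ℤ, ∀ i, |g i| < B := by
    obtain ⟨B, hB⟩ := (Set.finite_range fun i => |g i|).bddAbove
    exact ⟨B + 1, fun i => Int.lt_add_one_of_le (hB ⟨i, rfl⟩)⟩
  have hD : IsSubsystem P {i | Even (l i)} := by
    refine ⟨fun hk hi hj => ?_, fun {i} hi => ?_⟩
    · rw [Set.mem_ofPred_eq, h.additive.add hk]
      exact Even.add hi hj
    · rw [Set.mem_ofPred_eq, h.additive.opp]
      exact Even.neg hi
  -- Since `B` exceeds every `|g i|`, this functional has the sign of `-l` on levels ±2 and the sign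
  -- of `g` on level 0.
  have hf : IsAdditive P (fun i => g i - B * l i) := by
    refine ⟨fun hk => ?_, fun i => ?_⟩
    · rw [h.pos_additive.add hk, h.additive.add hk]; ring
    · rw [h.pos_additive.opp, h.additive.opp]; ring
  have hlev : ∀ i, Even (l i) → l i = -2 ∨ l i = 0 ∨ l i = 2 := by
    intro i hi
    have h1 := h.le_two i
    have h2 := h.neg_two_le i
    obtain ⟨r, hr⟩ := hi
    lia
  have hf0 : ∀ i ∈ {i | Even (l i)}, g i - B * l i ≠ 0 := by
    intro i hi
    have h1 := abs_lt.1 (hB i)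
    have h2 := h.pos_ne_zero i
    rcases hlev i hi with h3 | h3 | h3 <;> rw [h3] <;> lia
  rw [← encard_minimal_representatives hD hf hf0 h.pos_additive h.pos_ne_zero]
  congr 1
  ext v
  constructor
  · rintro ⟨hv, hv2⟩ i ⟨hi, hpos⟩
    have h1 := abs_lt.1 (hB i)
    dsimp only at hpos
    rcases hlev i hi with h3 | h3 | h3
    · have h4 := hv2 (P.reflectionPerm i i) (by rw [h.additive.opp]; lia)
      rwa [h.pos_smul_opp_iff, not_not] at h4
    · refine hv i h3 ?_
      rw [h3] at hpos
      lia
    · rw [h3] at hpos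
      lia
  · intro hv
    refine ⟨fun i hi hpos => hv i ⟨by simp [hi], by dsimp only; rw [hi]; lia⟩, fun i hi => ?_⟩
    have h1 := abs_lt.1 (hB i)
    have hio : l (P.reflectionPerm i i) = -2 := by rw [h.additive.opp, hi]
    have h2 := hv (P.reflectionPerm i i) ⟨by simp [hio], by
      dsimp only
      rw [hio, h.pos_additive.opp]; lia⟩
    rwa [h.pos_smul_opp_iff] at h2

end Levels

/-! ### Existence of the highest root of an irreducible root system. -/

section HighestRoot

variable {ι R M N : Type*} [CommRing R] [AddCommGroup M] [Module R M] [AddCommGroup N] [Module R N]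
  {P : RootPairing ι R M N} [CharZero R] (b : P.Base)

/-! ### Bases and the highest root -/

theorem isAdditive_height : IsAdditive P b.height :=
  ⟨fun h => b.height_add h, fun i => b.height_reflectionPerm_self i⟩

variable {b}

theorem exists_nat_coeff_of_isPos {i : ι} (hi : b.IsPos i) :
    ∃ f : ι → ℕ, P.root i = ∑ j ∈ b.support, f j • P.root j := by
  obtain ⟨f, -, hf | hf⟩ := b.exists_root_eq_sum_nat_or_neg i
  · exact ⟨f, hf⟩
  · exfalso
    have h1 : P.root i = ∑ j ∈ b.support, (fun j => -(f j : ℤ)) j • P.root j := by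
      simp [hf]
    have h2 := Base.height_eq_sum h1
    have h3 : ∑ j ∈ b.support, -(f j : ℤ) ≤ 0 := Finset.sum_nonpos fun j _ => by lia
    rw [Base.isPos_iff] at hi
    lia

theorem pairing_sum_eq [P.IsCrystallographic] {t : ι} {f : ι → ℕ} (hf : P.root t = ∑ j ∈ b.support, f j • P.root j)
    (k : ι) : P.pairingIn ℤ t k = ∑ j ∈ b.support, f j * P.pairingIn ℤ j k := by
  have h1 : P.pairing t k = ∑ j ∈ b.support, f j * P.pairing j k := by
    simp_rw [← root_coroot'_eq_pairing, hf, map_sum, map_nsmul, nsmul_eq_mul]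
  simp_rw [← P.algebraMap_pairingIn ℤ] at h1
  apply FaithfulSMul.algebraMap_injective ℤ R
  rw [h1]
  simp

variable [Finite ι] [IsDomain R] [P.IsCrystallographic]

theorem root_mem_closure_of_isPos {i : ι} (hi : b.IsPos i) :
    P.root i ∈ AddSubmonoid.closure (P.root '' b.support) :=
  hi.induction_on_add (p := fun i => P.root i ∈ AddSubmonoid.closure (P.root '' b.support))
    (fun _ hj => AddSubmonoid.subset_closure ⟨_, hj, rfl⟩)
    fun _ _ _ h h1 h2 => h ▸ add_mem h1 (AddSubmonoid.subset_closure ⟨_, h2, rfl⟩)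

theorem indec_posPart_height : indec P (posPart Set.univ b.height) = b.support := by
  ext i
  constructor
  · rintro ⟨hi, hind⟩
    have hpos : b.IsPos i := mem_posPart_univ.1 hi
    obtain ⟨j, hj, hji⟩ := hpos.exists_mem_support_pos_pairingIn
    by_contra hcon
    have hij : i ≠ j := fun h => hcon (h ▸ hj)
    obtain ⟨k, hk⟩ := P.root_sub_root_mem_of_pairingIn_pos ((P.zero_lt_pairingIn_iff' ℤ).1 hji) hij
    refine hind k (mem_posPart_univ.2 (hpos.sub hj hk)) j
      (mem_posPart_univ.2 (Base.isPos_of_mem_support hj)) ?_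
    rw [hk]; module
  · intro hi
    refine ⟨mem_posPart_univ.2 (Base.isPos_of_mem_support hi), fun j hj k hk h => ?_⟩
    have h1 := b.height_add h
    rw [Base.height_one_of_mem_support hi] at h1
    have h2 := mem_posPart_univ.1 hj
    have h3 := mem_posPart_univ.1 hk
    lia

/-- A positive root to which no positive root can be added. -/
def IsTopRoot (b : P.Base) (i : ι) : Prop :=
  b.IsPos i ∧ ∀ j k, b.IsPos j → P.root k ≠ P.root i + P.root j

theorem exists_isTopRoot {i : ι} (hi : b.IsPos i) :
    ∃ t, IsTopRoot b t ∧ P.root t - P.root i ∈ AddSubmonoid.closure (P.root '' b.support) := by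
  obtain ⟨B, hB⟩ := (Set.finite_range b.height).bddAbove
  generalize hn : (B - b.height i).toNat = n
  induction n using Nat.strong_induction_on generalizing i with
  | _ n ih =>
    by_cases htop : IsTopRoot b i
    · exact ⟨i, htop, by rw [sub_self]; exact zero_mem _⟩
    · obtain ⟨j, k, hj, hk⟩ : ∃ j k, b.IsPos j ∧ P.root k = P.root i + P.root j := by
        by_contra! hcon
        exact htop ⟨hi, hcon⟩
      have h1 := b.height_add hk
      have h2 : b.height k ≤ B := hB ⟨k, rfl⟩
      have h3 := (Base.isPos_iff b).1 hj
      obtain ⟨t, ht, htk⟩ := ih _ (by lia) (hi.add hj hk) rfl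
      refine ⟨t, ht, ?_⟩
      have h4 : P.root t - P.root i = (P.root t - P.root k) + P.root j := by rw [hk]; module
      rw [h4]
      exact add_mem htk (root_mem_closure_of_isPos hj)

theorem IsTopRoot.pairingIn_nonneg {t j : ι} (ht : IsTopRoot b t) (hj : j ∈ b.support) :
    0 ≤ P.pairingIn ℤ t j := by
  by_contra! hneg
  have hjp := Base.isPos_of_mem_support hj
  obtain ⟨k, hk⟩ := P.root_add_root_mem_of_pairingIn_neg hneg (fun h => by
    have h1 := (isAdditive_height b).eq_neg h
    have h2 := (Base.isPos_iff b).1 hjp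
    have h3 := (Base.isPos_iff b).1 ht.1
    lia)
  exact ht.2 j k hjp hk

variable [P.IsReduced] [P.IsIrreducible]

/-- In an irreducible root system all simple roots occur in a top root. -/
theorem IsTopRoot.coeff_pos {t : ι} (ht : IsTopRoot b t) {f : ι → ℕ}
    (hf : P.root t = ∑ j ∈ b.support, f j • P.root j) {j : ι} (hj : j ∈ b.support) : 0 < f j := by
  -- The span of the simple roots that occur in `t`. For a simple `k` that does not occur, `0 ≤ ⟨t,
  -- k⟩` is a sum of nonpositive terms, so `k` is orthogonal to all that do. Hence `q` is stable
  -- under reflections, irreducibility makes it everything, and linear independence forces every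
  -- simple root to occur.
  set q : Submodule R M := Submodule.span R (P.root '' {i | i ∈ b.support ∧ 0 < f i}) with hq
  have hzero : ∀ k ∈ b.support, f k = 0 → ∀ i ∈ b.support, 0 < f i → P.pairingIn ℤ i k = 0 := by
    intro k hk hfk i hi hfi
    have h1 := ht.pairingIn_nonneg hk
    rw [pairing_sum_eq hf] at h1
    have h2 : ∀ i ∈ b.support, (f i : ℤ) * P.pairingIn ℤ i k ≤ 0 := by
      intro i hi
      rcases eq_or_ne i k with rfl | hik
      · simp [hfk]
      · exact mul_nonpos_of_nonneg_of_nonpos (by positivity) (b.pairingIn_le_zero_of_ne hik hi hk)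
    have h3 := (Finset.sum_eq_zero_iff_of_nonpos h2).1
      (le_antisymm (Finset.sum_nonpos h2) h1) i hi
    rcases mul_eq_zero.1 h3 with h | h
    · lia
    · exact h
  have hinv : ∀ k, q ∈ Module.End.invtSubmodule (P.reflection k).toLinearMap := by
    rw [← b.forall_mem_support_invtSubmodule_iff]
    intro k hk
    rw [Module.End.mem_invtSubmodule, hq, Submodule.span_le]
    rintro _ ⟨i, ⟨hi, hfi⟩, rfl⟩
    have hiq : P.root i ∈ q := Submodule.subset_span ⟨i, ⟨hi, hfi⟩, rfl⟩
    change P.reflection k (P.root i) ∈ q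
    rw [reflection_apply_root' ℤ]
    rcases Nat.eq_zero_or_pos (f k) with hfk | hfk
    · rw [hzero k hk hfk i hi hfi, zero_smul, sub_zero]
      exact hiq
    · have hkq : P.root k ∈ q := Submodule.subset_span ⟨k, ⟨hk, hfk⟩, rfl⟩
      exact sub_mem hiq (zsmul_mem hkq _)
  have hne : q ≠ ⊥ := by
    intro hbot
    apply P.ne_zero t
    rw [hf]
    refine Finset.sum_eq_zero fun i hi => ?_
    rcases Nat.eq_zero_or_pos (f i) with hfi | hfi
    · rw [hfi, zero_smul]
    · have h1 : P.root i ∈ q := Submodule.subset_span ⟨i, ⟨hi, hfi⟩, rfl⟩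
      rw [hbot, Submodule.mem_bot] at h1
      rw [h1, smul_zero]
  have htop : q = ⊤ := IsIrreducible.eq_top_of_invtSubmodule_reflection q hinv hne
  by_contra hfj
  have hjq : P.root j ∈ q := htop ▸ Submodule.mem_top
  have h1 := b.linearIndepOn_root.notMem_span hj
  apply h1
  refine Submodule.span_mono (Set.image_mono ?_) hjq
  rintro i ⟨hi, hfi⟩
  exact ⟨hi, fun h => hfj (by rw [← Set.mem_singleton_iff.1 h]; exact hfi)⟩

/-- Two top roots pair positively, because all coefficients of `t` are positive and `s` pairs
nonnegatively with simple roots, positively with one. If distinct, their difference would be a root,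
and a positive root could be added to one of them. -/
theorem IsTopRoot.eq {s t : ι} (hs : IsTopRoot b s) (ht : IsTopRoot b t) : s = t := by
  obtain ⟨f, hf⟩ := exists_nat_coeff_of_isPos ht.1
  have hpos : 0 < P.pairingIn ℤ t s := by
    rw [pairing_sum_eq hf]
    have hnn : ∀ j ∈ b.support, 0 ≤ P.pairingIn ℤ j s := by
      intro j hj
      by_contra! hneg
      exact absurd ((P.pairingIn_lt_zero_iff ℤ).1 hneg) (not_lt.2 (hs.pairingIn_nonneg hj))
    obtain ⟨j, hj, hjs⟩ := hs.1.exists_mem_support_pos_pairingIn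
    refine Finset.sum_pos' (fun i hi => mul_nonneg (by positivity) (hnn i hi)) ⟨j, hj, ?_⟩
    exact mul_pos (by exact_mod_cast ht.coeff_pos hf hj) hjs
  by_contra hst
  obtain ⟨k, hk⟩ := P.root_sub_root_mem_of_pairingIn_pos hpos (Ne.symm hst)
  rcases Base.IsPos.or_neg b k with hkp | hkp
  · exact hs.2 k t hkp (by rw [hk]; module)
  · refine ht.2 _ s hkp ?_
    change P.root s = P.root t + P.root (P.reflectionPerm k k)
    rw [root_opp, hk]; module

/-- The highest root of an irreducible root system. -/
theorem exists_highest_root [Nonempty ι] (b : P.Base) : ∃ t, ∀ i,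
    P.root t - P.root i ∈ AddSubmonoid.closure (P.root '' b.support) := by
  obtain ⟨j, hj⟩ := b.support_nonempty
  obtain ⟨t, ht, -⟩ := exists_isTopRoot (Base.isPos_of_mem_support hj)
  refine ⟨t, fun i => ?_⟩
  rcases Base.IsPos.or_neg b i with hi | hi
  · obtain ⟨s, hs, hsi⟩ := exists_isTopRoot hi
    rwa [← hs.eq ht]
  · have h1 := root_mem_closure_of_isPos hi
    have h2 : P.root t - P.root i = P.root t + P.root (P.reflectionPerm i i) := by
      rw [root_opp]; module
    rw [h2]
    exact add_mem (root_mem_closure_of_isPos ht.1) h1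

end HighestRoot

/-! ### From the Lie algebra to roots and levels. -/

section RootSpaces

/-! ### The involution and the root spaces -/

theorem exp_mulVec_eq_smul {n : Type*} [Fintype n] [DecidableEq n] {A : Matrix n n ℂ} {v : n → ℂ}
    {c : ℂ} (h : A.mulVec v = c • v) :
    (NormedSpace.exp A).mulVec v = Complex.exp c • v := by
  -- The norm serves only for convergence of the exponential series, which is then applied to `v`
  -- term by term.
  let _ : NormedRing (Matrix n n ℂ) := Matrix.linftyOpNormedRing
  let _ : NormedAlgebra ℂ (Matrix n n ℂ) := Matrix.linftyOpNormedAlgebra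
  have hpow : ∀ k : ℕ, (A ^ k).mulVec v = c ^ k • v := by
    intro k
    induction k with
    | zero => simp
    | succ k ih => rw [pow_succ, ← Matrix.mulVec_mulVec, h, Matrix.mulVec_smul, ih, smul_smul,
        pow_succ, mul_comm]
  have hcont : Continuous fun B : Matrix n n ℂ => B.mulVec v :=
    continuous_id.matrix_mulVec continuous_const
  have h1 := (NormedSpace.exp_series_hasSum_exp' (𝕂 := ℂ) A).map
    ((Matrix.mulVecBilin ℂ ℂ).flip v) hcont
  have h2 := (NormedSpace.exp_series_hasSum_exp' (𝕂 := ℂ) c).smul_const v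
  rw [← Complex.exp_eq_exp_ℂ] at h2
  refine h1.unique ?_
  convert h2 using 2 with k
  change ((k.factorial : ℂ)⁻¹ • A ^ k).mulVec v = _
  rw [Matrix.smul_mulVec, hpow, smul_assoc]

theorem exp_pi_mul_even {m : ℤ} (hm : Even m) : Complex.exp (Real.pi * Complex.I * m) = 1 := by
  obtain ⟨r, rfl⟩ := hm
  rw [← Complex.exp_int_mul_two_pi_mul_I r]
  congr 1
  push_cast
  ring

theorem exp_pi_mul_odd {m : ℤ} (hm : Odd m) : Complex.exp (Real.pi * Complex.I * m) = -1 := by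
  obtain ⟨r, rfl⟩ := hm
  rw [← Complex.exp_pi_mul_I, ← one_mul (Complex.exp (Real.pi * Complex.I)),
    ← Complex.exp_int_mul_two_pi_mul_I r, ← Complex.exp_add]
  congr 1
  push_cast
  ring

variable {L : Type*} [LieRing L] [LieAlgebra ℂ L] [FiniteDimensional ℂ L]

theorem cartanInv_apply_of_eigen {H : LieSubalgebra ℂ L} {τ : H} {x : L} {c : ℂ}
    (h : ⁅(τ : L), x⁆ = c • x) :
    cartanInv τ x = Complex.exp (Real.pi * Complex.I * c) • x := by
  set B := Module.finBasis ℂ L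
  have h1 : (LinearMap.toMatrix B B
      (LieAlgebra.ad ℂ L (((Real.pi : ℂ) * Complex.I) • (τ : L)))).mulVec (B.repr x) =
      (Real.pi * Complex.I * c) • ⇑(B.repr x) := by
    rw [LinearMap.toMatrix_mulVec_repr, LieAlgebra.ad_apply, smul_lie, h, smul_smul, map_smul]
    rfl
  apply B.repr.injective
  apply DFunLike.coe_injective
  rw [map_smul, Finsupp.coe_smul, ← exp_mulVec_eq_smul h1, cartanInv,
    ← LinearMap.toMatrix_mulVec_repr B B, LinearMap.toMatrix_toLin]

theorem mem_kSub {H : LieSubalgebra ℂ L} {τ : H} {x : L} : x ∈ kSub τ ↔ cartanInv τ x = x := by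
  rw [kSub, Module.End.mem_eigenspace_iff, one_smul]

theorem mem_pSub {H : LieSubalgebra ℂ L} {τ : H} {x : L} : x ∈ pSub τ ↔ cartanInv τ x = -x := by
  rw [pSub, Module.End.mem_eigenspace_iff, neg_one_smul]

theorem eq_zero_of_mem_kSub_of_mem_pSub {H : LieSubalgebra ℂ L} {τ : H} {x : L} (hk : x ∈ kSub τ) (hp : x ∈ pSub τ) : x = 0 :=
  have : IsAddTorsionFree L := .of_isTorsionFree ℂ L
  self_eq_neg.1 ((mem_kSub.1 hk).symm.trans (mem_pSub.1 hp))

variable {H : LieSubalgebra ℂ L} [H.IsCartanSubalgebra]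

theorem mem_rootSp {α : H.root} {x : L} : x ∈ rootSp α ↔ x ∈ rootSpace H (α.1 : H → ℂ) := Iff.rfl

theorem exists_ne_zero_rootSp (α : H.root) : ∃ x ∈ rootSp α, x ≠ 0 := α.1.exists_ne_zero

theorem sumRootSp_le {Φ : Set H.root} {s : Submodule ℂ L} :
    sumRootSp Φ ≤ s ↔ ∀ α ∈ Φ, rootSp α ≤ s := iSup₂_le_iff

theorem rootSp_le_sumRootSp {Φ : Set H.root} {α : H.root} (h : α ∈ Φ) :
    rootSp α ≤ sumRootSp Φ := le_iSup₂_of_le α h le_rfl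

theorem sumRootSp_induction {Φ : Set H.root} {p : L → Prop} (h0 : p 0)
    (hα : ∀ α ∈ Φ, ∀ x ∈ rootSp α, p x) (hadd : ∀ x y, p x → p y → p (x + y)) {x : L}
    (hx : x ∈ sumRootSp Φ) : p x := by
  refine Submodule.iSup_induction' _ (motive := fun z _ => p z) (fun α z hz => ?_)
    h0 (fun _ _ _ _ => hadd _ _) hx
  exact Submodule.iSup_induction' _ (motive := fun z _ => p z) (fun h z hz => hα α h z hz)
    h0 (fun _ _ _ _ => hadd _ _) hz

/-- The root spaces and the Cartan subalgebra are independent. -/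
theorem mem_of_rootSp_le {Φ : Set H.root} {α : H.root}
    (h : rootSp α ≤ H.toSubmodule ⊔ sumRootSp Φ) : α ∈ Φ := by
  by_contra hα
  obtain ⟨x, hx, hx0⟩ := exists_ne_zero_rootSp α
  have hind := LieSubmodule.iSupIndep_toSubmodule.2 (LieModule.iSupIndep_genWeightSpace ℂ H L)
  have hdis := hind (α.1 : H → ℂ)
  suffices hle : H.toSubmodule ⊔ sumRootSp Φ ≤ ⨆ χ : H → ℂ, ⨆ (_ : χ ≠ (α.1 : H → ℂ)),
      (LieModule.genWeightSpace L χ).toSubmodule from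
    hx0 (Submodule.disjoint_def.1 hdis x hx (hle (h hx)))
  refine sup_le ?_ (sumRootSp_le.2 fun β hβ => ?_)
  · refine le_iSup₂_of_le (0 : H → ℂ) ?_ ?_
    · intro h0
      exact H.isNonZero_coe_root α h0.symm
    · exact LieAlgebra.toLieSubmodule_le_rootSpace_zero ℂ L H
  · refine le_iSup₂_of_le (β.1 : H → ℂ) ?_ le_rfl
    intro hβα
    exact hα (by rwa [← Subtype.ext (DFunLike.coe_injective hβα)])

/-- The roots `α` such that `𝔤_α` is contained in the subspace `s`. -/
def rootsIn (H : LieSubalgebra ℂ L) [H.IsCartanSubalgebra] (s : Submodule ℂ L) : Set H.root :=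
  {α | rootSp α ≤ s}

theorem rootsIn_sumRootSp (Φ : Set H.root) : rootsIn H (sumRootSp Φ) = Φ := by
  ext α
  exact ⟨fun h => mem_of_rootSp_le (h.trans le_sup_right), fun h => rootSp_le_sumRootSp h⟩

variable [LieAlgebra.IsSimple ℂ L]

theorem lie_of_mem_rootSp {α : H.root} {x : L} (hx : x ∈ rootSp α) (h : H) :
    ⁅(h : L), x⁆ = (rootSystem H).root α h • x :=
  lie_eq_smul_of_mem_rootSpace hx h

theorem lie_of_mem_cartan {x y : L} (hx : x ∈ H) (hy : y ∈ H) : ⁅x, y⁆ = 0 := by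
  have h1 : ⁅(⟨x, hx⟩ : H), (⟨y, hy⟩ : H)⁆ = 0 := trivial_lie_zero _ _ _ _
  simpa using congrArg Subtype.val h1

theorem rootSp_le_of_mem {α : H.root} {s : Submodule ℂ L} {x : L} (hx : x ∈ rootSp α)
    (hx0 : x ≠ 0) (hxs : x ∈ s) : rootSp α ≤ s := by
  have ha : IsAtom (rootSp α) := Submodule.isAtom_iff_finrank_eq_one.mpr
    (finrank_rootSpace_eq_one α.1 (H.isNonZero_coe_root α))
  by_contra hle
  have h1 := Submodule.disjoint_def.1 (ha.not_le_iff_disjoint.mp hle) x hx hxs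
  exact hx0 h1

theorem mem_rootSp_smul {α : H.root} {x y : L} (hx : x ∈ rootSp α) (hx0 : x ≠ 0)
    (hy : y ∈ rootSp α) : ∃ c : ℂ, y = c • x := by
  have h1 := rootSp_le_of_mem hx hx0 (Submodule.mem_span_singleton_self (R := ℂ) x) hy
  obtain ⟨c, hc⟩ := Submodule.mem_span_singleton.1 h1
  exact ⟨c, hc.symm⟩

/-- A subspace stable under the Cartan subalgebra is the sum of its intersection with the Cartan
subalgebra and of root spaces. -/
theorem eq_inf_cartan_sup_sumRootSp {s : Submodule ℂ L} (hs : ∀ h : H, ∀ y ∈ s, ⁅(h : L), y⁆ ∈ s) :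
    s = (s ⊓ H.toSubmodule) ⊔ sumRootSp {α : H.root | rootSp α ≤ s} := by
  refine le_antisymm ?_ (sup_le inf_le_left (sumRootSp_le.2 fun α hα => hα))
  let N : LieSubmodule ℂ H L := { s with lie_mem := fun {h y} hy => hs h y hy }
  have h1 : s = (⨆ χ : LieModule.Weight ℂ H L, N ⊓ LieModule.genWeightSpace L χ).toSubmodule :=
    congrArg LieSubmodule.toSubmodule (LieModule.eq_iSup_inf_genWeightSpace ℂ H L N)
  rw [LieSubmodule.iSup_toSubmodule] at h1
  conv_lhs => rw [h1]
  refine iSup_le fun χ => ?_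
  by_cases hχ : χ.IsZero
  · have h2 : LieModule.genWeightSpace L (χ : H → ℂ) = H.toLieSubmodule := by
      rw [hχ.eq]
      exact rootSpace_zero_eq ℂ L H
    rw [h2]
    exact le_sup_of_le_left le_rfl
  · have hroot : χ ∈ H.root := by simpa using hχ
    refine le_sup_of_le_right ?_
    rintro x ⟨hxs, hxχ⟩
    rcases eq_or_ne x 0 with rfl | hx0
    · exact zero_mem _
    · exact rootSp_le_sumRootSp (α := ⟨χ, hroot⟩)
        (rootSp_le_of_mem (α := ⟨χ, hroot⟩) hxχ hx0 hxs) hxχ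

theorem iSup_weight_induction {p : L → Prop} (hH : ∀ x ∈ H, p x)
    (hα : ∀ α : H.root, ∀ x ∈ rootSp α, p x) (hadd : ∀ x y, p x → p y → p (x + y)) (x : L) :
    p x := by
  have hx : x ∈ H.toSubmodule ⊔ sumRootSp {α : H.root | rootSp α ≤ ⊤} := by
    have h1 := eq_inf_cartan_sup_sumRootSp (H := H) (s := ⊤) (fun _ _ _ => Submodule.mem_top)
    rw [top_inf_eq] at h1
    rw [← h1]
    exact Submodule.mem_top
  obtain ⟨y, hy, z, hz, rfl⟩ := Submodule.mem_sup.1 hx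
  refine hadd _ _ (hH y hy) ?_
  refine Submodule.iSup_induction' _ (motive := fun z _ => p z) (fun α z hz => ?_)
    (hH 0 (zero_mem _)) (fun _ _ _ _ => hadd _ _) hz
  refine Submodule.iSup_induction' _ (motive := fun z _ => p z) (fun _ z hz => hα α z hz)
    (hH 0 (zero_mem _)) (fun _ _ _ _ => hadd _ _) hz

/-! ### Brackets of root spaces -/

theorem lie_mem_rootSp {α β γ : H.root}
    (h : (rootSystem H).root γ = (rootSystem H).root α + (rootSystem H).root β) {x y : L}
    (hx : x ∈ rootSp α) (hy : y ∈ rootSp β) : ⁅x, y⁆ ∈ rootSp γ := by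
  have h1 := lie_mem_genWeightSpace_of_mem_genWeightSpace (mem_rootSp.1 hx) (mem_rootSp.1 hy)
  have h2 : (γ.1 : H → ℂ) = (α.1 : H → ℂ) + (β.1 : H → ℂ) := by
    funext z; exact LinearMap.congr_fun h z
  rw [mem_rootSp, h2]
  exact h1

theorem lie_eq_zero_of_add_not_root {α β : H.root}
    (h : ∀ γ, (rootSystem H).root γ ≠ (rootSystem H).root α + (rootSystem H).root β)
    (h' : (rootSystem H).root α ≠ -(rootSystem H).root β) {x y : L}
    (hx : x ∈ rootSp α) (hy : y ∈ rootSp β) : ⁅x, y⁆ = 0 := by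
  have h1 := lie_mem_genWeightSpace_of_mem_genWeightSpace (mem_rootSp.1 hx) (mem_rootSp.1 hy)
  by_contra hne
  have hbot : LieModule.genWeightSpace L ((α.1 : H → ℂ) + (β.1 : H → ℂ)) ≠ ⊥ := by
    intro hbot
    rw [hbot] at h1
    exact hne ((LieSubmodule.mem_bot _).1 h1)
  let χ : LieModule.Weight ℂ H L := ⟨(α.1 : H → ℂ) + (β.1 : H → ℂ), hbot⟩
  by_cases hχ : χ.IsZero
  · apply h'
    rw [eq_neg_iff_add_eq_zero]
    ext z
    exact congrFun hχ z
  · refine h ⟨χ, by simpa using hχ⟩ ?_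
    ext z
    rfl

/-- By `sl₂`-theory on the `α`-string through `β`: up to a nonzero scalar `y` is `f ^ (k + 1)`
applied to a top vector, where `k + 1` is the distance from `β` to the top. Applying `e` multiplies
`f ^ k` of that vector by `(k + 1) (n - k)`, with `n` the length of the string and `k < n`. -/
theorem lie_ne_zero_of_add_root {α β γ : H.root}
    (h : (rootSystem H).root γ = (rootSystem H).root α + (rootSystem H).root β) {x y : L}
    (hx : x ∈ rootSp α) (hx0 : x ≠ 0) (hy : y ∈ rootSp β) (hy0 : y ≠ 0) : ⁅x, y⁆ ≠ 0 := by
  have hα := H.isNonZero_coe_root α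
  obtain ⟨h', e, f, ht, he, hf⟩ := exists_isSl2Triple_of_weight_isNonZero hα
  obtain rfl := ht.h_eq_coroot hα he hf
  have h2 : (γ.1 : H → ℂ) = (1 : ℤ) • (α.1 : H → ℂ) + (β.1 : H → ℂ) := by
    rw [one_smul]; funext z; exact LinearMap.congr_fun h z
  have h3 : 1 ≤ LieModule.chainTopCoeff (α.1 : H → ℂ) β.1 := by
    have := ((rootSpace_zsmul_add_ne_bot_iff α.1 β.1 hα 1).1
      (by rw [← h2]; exact γ.1.genWeightSpace_ne_bot)).1
    exact_mod_cast this
  obtain ⟨k, hk⟩ := Nat.exists_eq_add_of_le' h3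
  have h4 := chainTopCoeff_le_chainLength α.1 β.1
  obtain ⟨v, hv, hv0⟩ := (LieModule.chainTop (α.1 : H → ℂ) β.1).exists_ne_zero
  have prim : ht.HasPrimitiveVectorWith v (chainLength α.1 β.1 : ℂ) :=
    have := lie_mem_genWeightSpace_of_mem_genWeightSpace he hv
    ⟨hv0, (chainLength_smul _ _ hv).symm, by
      rwa [LieModule.genWeightSpace_add_chainTop _ _ hα] at this⟩
  have hmem := LieAlgebra.toEnd_pow_apply_mem hf hv (k + 1)
  have hwt : (k + 1) • (-(α.1 : H → ℂ)) + (LieModule.chainTop (α.1 : H → ℂ) β.1 : H → ℂ) =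
      β.1 := by
    rw [LieModule.coe_chainTop', hk]
    simp
  rw [hwt] at hmem
  have hne := prim.pow_toEnd_f_ne_zero_of_eq_nat rfl (hk ▸ h4)
  obtain ⟨c, rfl⟩ := mem_rootSp_smul (α := β) hmem hne hy
  obtain ⟨d, rfl⟩ := mem_rootSp_smul (α := α) he ht.e_ne_zero hx
  have hc : c ≠ 0 := fun hc => hy0 (by rw [hc, zero_smul])
  have hd : d ≠ 0 := fun hd => hx0 (by rw [hd, zero_smul])
  rw [lie_smul, smul_lie, prim.lie_e_pow_succ_toEnd_f]
  refine smul_ne_zero hc (smul_ne_zero hd (smul_ne_zero (mul_ne_zero ?_ ?_) ?_))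
  · exact_mod_cast Nat.succ_ne_zero k
  · rw [sub_ne_zero]
    exact_mod_cast (by lia : chainLength α.1 β.1 ≠ k)
  · exact prim.pow_toEnd_f_ne_zero_of_eq_nat rfl (by lia)

variable {b : (rootSystem H).Base} {τ z : H}

/-! ### Levels -/

/-- The integer `(τ, α)`, for `τ` in the coweight lattice. -/
def level (τ : H) (α : H.root) : ℤ := ⌊pair τ α⌋

theorem root_eq_level (hτ : τ ∈ coweights H) (α : H.root) :
    (rootSystem H).root α τ = (level τ α : ℂ) := by
  obtain ⟨k, hk⟩ := hτ α
  have h1 : level τ α = k := by rw [level, pair, hk, Complex.intCast_re, Int.floor_intCast]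
  rw [h1, hk]

theorem pair_eq_level (hτ : τ ∈ coweights H) (α : H.root) : pair τ α = level τ α := by
  rw [pair, root_eq_level hτ, Complex.intCast_re]

theorem pair_neg_iff (hτ : τ ∈ coweights H) {α : H.root} : pair τ α < 0 ↔ level τ α < 0 := by
  rw [pair_eq_level hτ]
  exact Int.cast_lt_zero

theorem isAdditive_level (hτ : τ ∈ coweights H) : IsAdditive (rootSystem H) (level τ) := by
  refine ⟨fun {i j k} h => ?_, fun i => ?_⟩
  · have h1 := LinearMap.congr_fun h τ
    rw [LinearMap.add_apply, root_eq_level hτ, root_eq_level hτ, root_eq_level hτ] at h1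
    exact_mod_cast h1
  · have h1 := LinearMap.congr_fun (root_opp (P := rootSystem H) i) τ
    rw [LinearMap.neg_apply, root_eq_level hτ, root_eq_level hτ] at h1
    exact_mod_cast h1

theorem re_nonneg_of_mem_closure (h : ∀ i ∈ b.support, 0 ≤ pair τ i) {f : Module.Dual ℂ H}
    (hf : f ∈ AddSubmonoid.closure ((rootSystem H).root '' b.support)) : 0 ≤ (f τ).re := by
  induction hf using AddSubmonoid.closure_induction with
  | mem x hx => obtain ⟨i, hi, rfl⟩ := hx; exact h i hi
  | zero => simp
  | add x y _ _ hx hy => rw [LinearMap.add_apply, Complex.add_re]; exact add_nonneg hx hy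

theorem nonempty_root (H : LieSubalgebra ℂ L) [H.IsCartanSubalgebra] : Nonempty H.root := by
  by_contra hemp
  rw [not_nonempty_iff] at hemp
  have h1 : (rootSystem H).rootSpan ℂ = ⊤ := IsRootSystem.span_root_eq_top
  have h2 : Nontrivial (Module.Dual ℂ H) := IsIrreducible.nontrivial (rootSystem H)
  have h3 : (rootSystem H).rootSpan ℂ = ⊥ := by
    rw [rootSpan, Set.range_eq_empty, Submodule.span_empty]
  exact bot_ne_top (h3.symm.trans h1)

theorem isGrading_level (hτ : τ ∈ alcoveX b) :
    IsGrading (rootSystem H) b.height (level τ) := by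
  obtain ⟨hτc, hτs, hτθ⟩ := hτ
  refine ⟨isAdditive_height b, b.height_ne_zero, isAdditive_level hτc, fun i hi => ?_, fun i => ?_⟩
  · have h1 := re_nonneg_of_mem_closure hτs (root_mem_closure_of_isPos (b := b) hi)
    change 0 ≤ pair τ i at h1
    rw [pair_eq_level hτc] at h1
    exact_mod_cast h1
  · have := nonempty_root H
    -- `alcoveX` bounds `τ` on every highest root, which has content only once one is known to
    -- exist.
    obtain ⟨t, ht⟩ := exists_highest_root b
    have h1 := hτθ t ht
    have h2 := re_nonneg_of_mem_closure hτs (ht i)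
    rw [LinearMap.sub_apply, Complex.sub_re] at h2
    change 0 ≤ pair τ t - pair τ i at h2
    have h3 : pair τ i ≤ 2 := by linarith
    rw [pair_eq_level hτc] at h3
    exact_mod_cast h3

/-! ### The elements `v_z` -/

theorem actRoot_eq_smul (w : Weyl H) (α : H.root) : actRoot w α = w • α := rfl

theorem pair_actCartan (w : Weyl H) (x : H) (α : H.root) :
    pair (actCartan w x) α = pair x (w⁻¹ • α) := by
  rw [pair, root_actCartan, actRoot_eq_smul, pair]

theorem actCartan_mul (v w : Weyl H) (x : H) :
    actCartan (v * w) x = actCartan v (actCartan w x) := by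
  rw [actCartan, mul_inv_rev]
  rfl

theorem actCartan_one (x : H) : actCartan (1 : Weyl H) x = x := by
  rw [actCartan, inv_one]
  rfl

theorem actCartan_mem_coweights (w : Weyl H) (hτ : τ ∈ coweights H) :
    actCartan w τ ∈ coweights H := fun α => by
  rw [root_actCartan]
  exact hτ _

theorem isV_iff {v : Weyl H} :
    IsV b z v ↔ ∀ α, b.IsPos α → (¬ b.IsPos (v⁻¹ • α) ↔ pair z α < 0) := by
  rw [IsV, inversions, Set.ext_iff]
  exact forall_congr' fun α => and_congr_right_iff

theorem isPos_smul_opp_iff (w : Weyl H) (α : H.root) :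
    b.IsPos (w • (rootSystem H).reflectionPerm α α) ↔ ¬ b.IsPos (w • α) := by
  rw [smul_opp]
  exact Base.IsPos.neg_iff_not b (w • α)

theorem existsUnique_isV (b : (rootSystem H).Base) (hz : z ∈ coweights H) :
    ∃! v, IsV b z v := by
  have hl := isAdditive_level hz
  have hg := isAdditive_height b
  -- Roots are ordered by their value on `z`, with ties broken by height. The element taking this
  -- positive system to the standard one is `v_z⁻¹`.
  have hQ : IsPositiveSystem (rootSystem H) Set.univ
      {α | 0 < level z α ∨ (level z α = 0 ∧ 0 < b.height α)} := by
    refine ⟨fun _ _ => trivial, fun h hi hj => ?_, fun {i} _ => ?_⟩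
    · have h1 := hl.add h
      have h2 := hg.add h
      rw [Set.mem_ofPred_eq] at *
      lia
    · have h1 := hl.opp i
      have h2 := hg.opp i
      have h3 := b.height_ne_zero i
      simp only [Set.mem_ofPred_eq]
      lia
  obtain ⟨w, -, hw⟩ := exists_smul_mem_posPart_iff isSubsystem_univ hg
    (fun i _ => b.height_ne_zero i) hQ
  refine ⟨w⁻¹, isV_iff.2 fun α hα => ?_, fun v hv => ?_⟩
  · have h1 := hw α trivial
    rw [mem_posPart_univ, Set.mem_ofPred_eq] at h1
    rw [inv_inv, Base.isPos_iff, h1, pair_neg_iff hz]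
    have h2 : 0 < b.height α := hα
    lia
  · rw [← inv_inj, inv_inv]
    refine eq_of_pos_smul_imp hg b.height_ne_zero fun α hα => ?_
    have key : ∀ α, b.IsPos α → (b.IsPos (v⁻¹ • α) ↔ 0 < b.height (w • α)) := by
      intro α hα
      rw [← not_iff_not, isV_iff.1 hv α hα, pair_neg_iff hz]
      have h1 := hw α trivial
      rw [mem_posPart_univ, Set.mem_ofPred_eq] at h1
      rw [h1]
      have h2 : 0 < b.height α := hα
      lia
    rcases Base.IsPos.or_neg b α with hpos | hpos
    · exact (key α hpos).1 hα
    · have h1 := (key _ hpos).not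
      rw [show ((rootSystem H).indexNeg.neg α) = (rootSystem H).reflectionPerm α α from rfl,
        isPos_smul_opp_iff, not_not, ← Base.isPos_iff, isPos_smul_opp_iff, not_not] at h1
      exact h1.1 hα

theorem isV_vOf (b : (rootSystem H).Base) (hz : z ∈ coweights H) : IsV b z (vOf b z) :=
  Classical.epsilon_spec (existsUnique_isV b hz).exists

theorem vOf_eq (hz : z ∈ coweights H) {v : Weyl H} (hv : IsV b z v) : vOf b z = v :=
  (existsUnique_isV b hz).unique (isV_vOf b hz) hv

theorem eq_actCartan_of_dom_eq (h : dom b z = τ) : z = actCartan (vOf b z) τ := by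
  rw [← h, dom, ← actCartan_mul, mul_inv_cancel, actCartan_one]

theorem pair_smul_of_dom_eq (hτ : τ ∈ coweights H) (h : dom b z = τ) (α : H.root) :
    pair z (vOf b z • α) = level τ α := by
  conv_lhs => enter [1]; rw [eq_actCartan_of_dom_eq h]
  rw [pair_actCartan, inv_smul_smul, pair_eq_level hτ]

/-- If a positive `i` of level zero became negative, `-v_z i` would be an inversion on which `z`
vanishes, whereas `z` is negative on inversions. -/
theorem vOf_mem_levelReps (hτ : τ ∈ coweights H) (hz : z ∈ coweights H) (h : dom b z = τ) :
    vOf b z ∈ levelReps (rootSystem H) b.height (level τ) := by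
  intro i hi hpos
  by_contra hneg
  have h1 : b.IsPos (vOf b z • (rootSystem H).reflectionPerm i i) :=
    (isPos_smul_opp_iff _ _).2 hneg
  have h2 := isV_iff.1 (isV_vOf b hz) _ h1
  rw [inv_smul_smul, pair_smul_of_dom_eq hτ h, (isAdditive_level hτ).opp, hi] at h2
  simp only [neg_zero, Int.cast_zero, lt_irrefl, iff_false, not_not] at h2
  have h3 := (isAdditive_height b).opp i
  have h4 : 0 < b.height ((rootSystem H).reflectionPerm i i) := h2
  lia

theorem isV_actCartan (hτ : τ ∈ alcoveX b) {v : Weyl H}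
    (hv : v ∈ levelReps (rootSystem H) b.height (level τ)) : IsV b (actCartan v τ) v := by
  have hgr := isGrading_level hτ
  rw [isV_iff]
  intro α hα
  rw [pair_actCartan, pair_neg_iff hτ.1]
  constructor
  · intro hneg
    by_contra hlev
    have h0 := hgr.pos_ne_zero (v⁻¹ • α)
    have hneg' : ¬ 0 < b.height (v⁻¹ • α) := hneg
    have h1 := hgr.pos_additive.opp (v⁻¹ • α)
    have h2 := hgr.additive.opp (v⁻¹ • α)
    have h3 := hgr.nonneg _ (by lia : 0 < b.height ((rootSystem H).reflectionPerm (v⁻¹ • α) (v⁻¹ • α)))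
    have h4 := hv _ (by lia : level τ ((rootSystem H).reflectionPerm (v⁻¹ • α) (v⁻¹ • α)) = 0) (by lia)
    rw [hgr.pos_smul_opp_iff, smul_inv_smul] at h4
    exact h4 hα
  · intro hlev hpos
    have := hgr.nonneg _ hpos
    lia

theorem vOf_actCartan (hτ : τ ∈ alcoveX b) {v : Weyl H}
    (hv : v ∈ levelReps (rootSystem H) b.height (level τ)) : vOf b (actCartan v τ) = v :=
  vOf_eq (actCartan_mem_coweights v hτ.1) (isV_actCartan hτ hv)

theorem dom_actCartan (hτ : τ ∈ alcoveX b) {v : Weyl H}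
    (hv : v ∈ levelReps (rootSystem H) b.height (level τ)) : dom b (actCartan v τ) = τ := by
  rw [dom, vOf_actCartan hτ hv, ← actCartan_mul, inv_mul_cancel, actCartan_one]

/-- The condition `(z, αᵢ) ≤ 1` excludes exactly level 2 at `v⁻¹ αᵢ`. The bound at `θ` is automatic,
since every level is at least -2. -/
theorem bijOn_vOf_hatZ (hτ : τ ∈ alcoveX b) :
    Set.BijOn (vOf b) (hatZ b τ) (hatReps (rootSystem H) b.height (level τ)) := by
  refine ⟨?_, ?_, ?_⟩
  · rintro z ⟨⟨hz, hzs, -⟩, hdom⟩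
    refine ⟨vOf_mem_levelReps hτ.1 hz hdom, fun i hi hmem => ?_⟩
    rw [indec_posPart_height] at hmem
    have h1 := hzs _ hmem
    rw [pair_smul_of_dom_eq hτ.1 hdom, hi] at h1
    norm_num at h1
  · rintro z ⟨-, hz⟩ z' ⟨-, hz'⟩ h
    rw [eq_actCartan_of_dom_eq hz, eq_actCartan_of_dom_eq hz', h]
  · rintro v ⟨hv, hv2⟩
    refine ⟨actCartan v τ, ⟨⟨actCartan_mem_coweights v hτ.1, fun i hi => ?_, fun θ _ => ?_⟩,
      dom_actCartan hτ hv⟩, vOf_actCartan hτ hv⟩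
    · rw [pair_actCartan, pair_eq_level hτ.1]
      have h1 := (isGrading_level hτ).le_two (v⁻¹ • i)
      have h2 : level τ (v⁻¹ • i) ≠ 2 := fun h => by
        have h3 := hv2 _ h
        rw [smul_inv_smul, indec_posPart_height] at h3
        exact h3 hi
      exact_mod_cast (by lia : level τ (v⁻¹ • i) ≤ 1)
    · rw [pair_actCartan, pair_eq_level hτ.1]
      exact_mod_cast (isGrading_level hτ).neg_two_le (v⁻¹ • θ)

theorem tildeZtau_subset_hatZ (hτ : τ ∈ alcoveX b) : tildeZtau b τ ⊆ hatZ b τ := by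
  rintro z ⟨⟨hz, hzab⟩, hdom⟩
  refine ⟨⟨hz, fun i hi => ?_, fun θ _ => ?_⟩, hdom⟩
  · rcases hzab i (Base.isPos_of_mem_support hi) with h | h | h | h <;> rw [h] <;> norm_num
  · have h1 := pair_smul_of_dom_eq hτ.1 hdom ((vOf b z)⁻¹ • θ)
    rw [smul_inv_smul] at h1
    rw [h1]
    exact_mod_cast (isGrading_level hτ).neg_two_le _

theorem bijOn_vOf_tildeZtau (hτ : τ ∈ alcoveX b) :
    Set.BijOn (vOf b) (tildeZtau b τ) (abReps (rootSystem H) b.height (level τ)) := by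
  refine ⟨?_, (bijOn_vOf_hatZ hτ).injOn.mono (tildeZtau_subset_hatZ hτ), ?_⟩
  · rintro z ⟨⟨hz, hzab⟩, hdom⟩
    refine ⟨vOf_mem_levelReps hτ.1 hz hdom, fun i hi hpos => ?_⟩
    have h1 := hzab _ hpos
    rw [pair_smul_of_dom_eq hτ.1 hdom, hi] at h1
    rcases h1 with h | h | h | h <;> norm_num at h
  · rintro v ⟨hv, hv2⟩
    refine ⟨actCartan v τ, ⟨⟨actCartan_mem_coweights v hτ.1, fun β hβ => ?_⟩,
      dom_actCartan hτ hv⟩, vOf_actCartan hτ hv⟩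
    rw [pair_actCartan, pair_eq_level hτ.1]
    have h1 := (isGrading_level hτ).le_two (v⁻¹ • β)
    have h2 := (isGrading_level hτ).neg_two_le (v⁻¹ • β)
    have h3 : level τ (v⁻¹ • β) ≠ 2 := fun h => by
      have h4 := hv2 _ h
      rw [smul_inv_smul] at h4
      exact h4 hβ
    have h4 : level τ (v⁻¹ • β) = 0 ∨ level τ (v⁻¹ • β) = -1 ∨ level τ (v⁻¹ • β) = 1 ∨
      level τ (v⁻¹ • β) = -2 := by lia
    rcases h4 with h | h | h | h <;> rw [h] <;> simp

theorem idealMap_eq (hτ : τ ∈ coweights H) (hdom : dom b z = τ) :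
    idealMap b z = sumRootSp (levelOne b.height (level τ) (vOf b z)) := by
  rw [idealMap]
  congr 1
  ext α
  constructor
  · rintro ⟨β, ⟨hβ, hβ1⟩, rfl⟩
    rw [actRoot_eq_smul]
    have h1 := pair_smul_of_dom_eq hτ hdom ((vOf b z)⁻¹ • β)
    rw [smul_inv_smul, hβ1] at h1
    refine ⟨by exact_mod_cast h1.symm, ?_⟩
    rw [smul_inv_smul]
    exact hβ
  · rintro ⟨hα, hpos⟩
    refine ⟨vOf b z • α, ⟨hpos, ?_⟩, ?_⟩
    · rw [pair_smul_of_dom_eq hτ hdom, hα, Int.cast_one]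
    · rw [actRoot_eq_smul, inv_smul_smul]

/-! ### Submodules -/

theorem cartanInv_apply_of_mem_rootSp (hτ : τ ∈ coweights H) {α : H.root} {x : L}
    (hx : x ∈ rootSp α) :
    cartanInv τ x = Complex.exp (Real.pi * Complex.I * level τ α) • x := by
  rw [← root_eq_level hτ]
  exact cartanInv_apply_of_eigen (lie_of_mem_rootSp hx τ)

theorem cartanInv_apply_of_mem_cartan {x : L} (hx : x ∈ H) : cartanInv τ x = x := by
  have h1 := cartanInv_apply_of_eigen (τ := τ) (x := x) (c := 0)
    (by rw [lie_of_mem_cartan τ.2 hx, zero_smul])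
  rwa [mul_zero, Complex.exp_zero, one_smul] at h1

theorem rootSp_le_kSub_of_even (hτ : τ ∈ coweights H) {α : H.root} (h : Even (level τ α)) :
    rootSp α ≤ kSub τ := fun x hx => by
  rw [mem_kSub, cartanInv_apply_of_mem_rootSp hτ hx, exp_pi_mul_even h, one_smul]

theorem rootSp_le_pSub_of_odd (hτ : τ ∈ coweights H) {α : H.root} (h : Odd (level τ α)) :
    rootSp α ≤ pSub τ := fun x hx => by
  rw [mem_pSub, cartanInv_apply_of_mem_rootSp hτ hx, exp_pi_mul_odd h, neg_one_smul]

theorem rootSp_le_kSub_iff (hτ : τ ∈ coweights H) {α : H.root} :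
    rootSp α ≤ kSub τ ↔ Even (level τ α) := by
  refine ⟨fun h => ?_, rootSp_le_kSub_of_even hτ⟩
  by_contra hodd
  obtain ⟨x, hx, hx0⟩ := exists_ne_zero_rootSp α
  exact hx0 (eq_zero_of_mem_kSub_of_mem_pSub (h hx)
    (rootSp_le_pSub_of_odd hτ (Int.not_even_iff_odd.1 hodd) hx))

theorem rootSp_le_pSub_iff (hτ : τ ∈ coweights H) {α : H.root} :
    rootSp α ≤ pSub τ ↔ Odd (level τ α) := by
  refine ⟨fun h => ?_, rootSp_le_pSub_of_odd hτ⟩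
  by_contra heven
  obtain ⟨x, hx, hx0⟩ := exists_ne_zero_rootSp α
  exact hx0 (eq_zero_of_mem_kSub_of_mem_pSub
    (rootSp_le_kSub_of_even hτ (Int.not_odd_iff_even.1 heven) hx) (h hx))

theorem cartan_le_borel_inf_kSub : H.toSubmodule ≤ borel b ⊓ kSub τ :=
  le_inf le_sup_left fun _ hx => mem_kSub.2 (cartanInv_apply_of_mem_cartan hx)

theorem rootSp_le_borel_iff {α : H.root} : rootSp α ≤ borel b ↔ b.IsPos α :=
  ⟨fun h => mem_of_rootSp_le h, fun h => le_sup_of_le_right (rootSp_le_sumRootSp h)⟩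

theorem lie_mem_sumRootSp {Φ : Set H.root} {h : L} (hh : h ∈ H) {y : L} (hy : y ∈ sumRootSp Φ) :
    ⁅h, y⁆ ∈ sumRootSp Φ := by
  refine sumRootSp_induction (p := fun y => ⁅h, y⁆ ∈ sumRootSp Φ) (by simp) (fun α hα x hx => ?_)
    (fun x y hx hy => by rw [lie_add]; exact add_mem hx hy) hy
  rw [lie_of_mem_rootSp hx ⟨h, hh⟩]
  exact Submodule.smul_mem _ _ (rootSp_le_sumRootSp hα hx)

theorem lie_mem_borel_inf_kSub (hτ : τ ∈ coweights H) (h : H) {y : L}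
    (hy : y ∈ borel b ⊓ kSub τ) : ⁅(h : L), y⁆ ∈ borel b ⊓ kSub τ := by
  refine ⟨?_, ?_⟩
  · obtain ⟨x, hx, z, hz, rfl⟩ := Submodule.mem_sup.1 hy.1
    rw [lie_add, lie_of_mem_cartan h.2 hx, zero_add]
    exact Submodule.mem_sup_right (lie_mem_sumRootSp h.2 hz)
  · have key : cartanInv τ ⁅(h : L), y⁆ = ⁅(h : L), cartanInv τ y⁆ := by
      refine iSup_weight_induction (H := H)
        (p := fun y => cartanInv τ ⁅(h : L), y⁆ = ⁅(h : L), cartanInv τ y⁆) ?_ ?_ ?_ y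
      · intro x hx
        rw [lie_of_mem_cartan h.2 hx, map_zero, cartanInv_apply_of_mem_cartan hx,
          lie_of_mem_cartan h.2 hx]
      · intro α x hx
        rw [lie_of_mem_rootSp hx, map_smul, cartanInv_apply_of_mem_rootSp hτ hx, lie_smul,
          lie_of_mem_rootSp hx, smul_comm]
      · intro x y hx hy
        rw [lie_add, map_add, map_add, lie_add, hx, hy]
    exact mem_kSub.2 (key.trans (congrArg _ (mem_kSub.1 hy.2)))

/-- The submodule is stable under the Cartan subalgebra, which lies in `𝔟 ∩ 𝔨_τ`, so it splits into
weight parts. It has no Cartan part because `𝔨_τ ∩ 𝔭_τ = 0`. -/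
theorem sumRootSp_rootsIn {s : Submodule ℂ L} (hs : s ∈ submodulesS b τ) :
    sumRootSp (rootsIn H s) = s := by
  have h1 := eq_inf_cartan_sup_sumRootSp (H := H) (s := s)
    (fun h y hy => hs.2 _ (cartan_le_borel_inf_kSub h.2) y hy)
  have h2 : s ⊓ H.toSubmodule = ⊥ := by
    rw [Submodule.eq_bot_iff]
    rintro x ⟨hxs, hxH⟩
    exact eq_zero_of_mem_kSub_of_mem_pSub (cartan_le_borel_inf_kSub (b := b) hxH).2 (hs.1 hxs).2
  rw [h2, bot_sup_eq] at h1
  exact h1.symm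

theorem rootsIn_mem_stableSets (hτ : τ ∈ alcoveX b) {s : Submodule ℂ L}
    (hs : s ∈ submodulesS b τ) :
    rootsIn H s ∈ stableSets (rootSystem H) b.height (level τ) := by
  have hgr := isGrading_level hτ
  refine ⟨fun α hα => ?_, fun α β γ h hα hβ hβ' => ?_⟩
  · have hpos : b.IsPos α := rootSp_le_borel_iff.1 (le_trans hα (hs.1.trans inf_le_left))
    have hodd := (rootSp_le_pSub_iff hτ.1).1 (le_trans hα (hs.1.trans inf_le_right))
    have h1 := hgr.le_two α
    have h2 := hgr.nonneg α hpos
    obtain ⟨k, hk⟩ := hodd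
    lia
  · obtain ⟨x, hx, hx0⟩ := exists_ne_zero_rootSp α
    obtain ⟨y, hy, hy0⟩ := exists_ne_zero_rootSp β
    have hyk : y ∈ borel b ⊓ kSub τ := ⟨rootSp_le_borel_iff.2 hβ' hy,
      (rootSp_le_kSub_iff hτ.1).2 (by rw [hβ]; exact Even.zero) hy⟩
    rw [add_comm] at h
    exact rootSp_le_of_mem (lie_mem_rootSp h hy hx) (lie_ne_zero_of_add_root h hy hy0 hx hx0)
      (hs.2 y hyk x (hα hx))

theorem sumRootSp_mem_submodulesS (hτ : τ ∈ alcoveX b) {Φ : Set H.root}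
    (hΦ : Φ ∈ stableSets (rootSystem H) b.height (level τ)) :
    sumRootSp Φ ∈ submodulesS b τ := by
  have hgr := isGrading_level hτ
  have hpos : ∀ α ∈ Φ, b.IsPos α := by
    intro α hα
    by_contra hneg
    have h1 := hgr.pos_additive.opp α
    have h2 := hgr.pos_ne_zero α
    have h3 := hgr.additive.opp α
    have h4 : ¬ 0 < b.height α := hneg
    have h5 := hgr.nonneg _ (by lia : 0 < b.height ((rootSystem H).reflectionPerm α α))
    have h6 := hΦ.1 α hα
    lia
  refine ⟨sumRootSp_le.2 fun α hα => le_inf (rootSp_le_borel_iff.2 (hpos α hα))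
    ((rootSp_le_pSub_iff hτ.1).2 (by rw [hΦ.1 α hα]; exact odd_one)), fun x hx y hy => ?_⟩
  rw [eq_inf_cartan_sup_sumRootSp (H := H) (s := borel b ⊓ kSub τ)
    (fun h y hy => lie_mem_borel_inf_kSub hτ.1 h hy)] at hx
  obtain ⟨h, hh, x', hx', rfl⟩ := Submodule.mem_sup.1 hx
  rw [add_lie]
  refine add_mem (lie_mem_sumRootSp hh.2 hy) ?_
  refine sumRootSp_induction (p := fun x => ⁅x, y⁆ ∈ sumRootSp Φ) (by simp) (fun β hβ x hx => ?_)
    (fun x y hx hy => by rw [add_lie]; exact add_mem hx hy) hx'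
  refine sumRootSp_induction (p := fun y => ⁅x, y⁆ ∈ sumRootSp Φ) (by simp) (fun α hα y hy => ?_)
    (fun y y' hy hy' => by rw [lie_add]; exact add_mem hy hy') hy
  have hβpos : b.IsPos β := rootSp_le_borel_iff.1 (le_trans hβ inf_le_left)
  obtain ⟨k, hk⟩ := (rootSp_le_kSub_iff hτ.1).1 (le_trans hβ inf_le_right)
  by_cases hroot : ∃ γ, (rootSystem H).root γ = (rootSystem H).root β + (rootSystem H).root α
  · obtain ⟨γ, hγ⟩ := hroot
    -- The level of `β` is 0 or 2; since `α` has level 1 and `γ` at most 2, it is 0, and stability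
    -- applies.
    have h1 := hgr.additive.add hγ
    have h2 := hgr.le_two γ
    have h3 := hgr.nonneg β hβpos
    have h4 := hΦ.1 α hα
    refine rootSp_le_sumRootSp ?_ (lie_mem_rootSp hγ hx hy)
    exact hΦ.2 α β γ (by rw [hγ, add_comm]) hα (by lia) hβpos
  · push Not at hroot
    have hne : (rootSystem H).root β ≠ -(rootSystem H).root α := fun h => by
      have h1 := hgr.additive.eq_neg h
      have h4 := hΦ.1 α hα
      lia
    rw [lie_eq_zero_of_add_not_root hroot hne hx hy]
    exact zero_mem _

theorem bijOn_sumRootSp (hτ : τ ∈ alcoveX b) :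
    Set.BijOn sumRootSp (stableSets (rootSystem H) b.height (level τ)) (submodulesS b τ) := by
  refine ⟨fun Φ hΦ => sumRootSp_mem_submodulesS hτ hΦ, fun Φ _ Ψ _ h => ?_,
    fun s hs => ⟨_, rootsIn_mem_stableSets hτ hs, sumRootSp_rootsIn hs⟩⟩
  rw [← rootsIn_sumRootSp Φ, ← rootsIn_sumRootSp Ψ, h]

theorem sumRootSp_abelian_iff (hτ : τ ∈ alcoveX b) {Φ : Set H.root}
    (hΦ : Φ ∈ stableSets (rootSystem H) b.height (level τ)) :
    (∀ x ∈ sumRootSp Φ, ∀ y ∈ sumRootSp Φ, ⁅x, y⁆ = 0) ↔ rootSums (rootSystem H) Φ = ∅ := by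
  have hgr := isGrading_level hτ
  constructor
  · intro h
    refine Set.eq_empty_of_forall_notMem ?_
    rintro γ ⟨α, hα, β, hβ, hγ⟩
    obtain ⟨x, hx, hx0⟩ := exists_ne_zero_rootSp α
    obtain ⟨y, hy, hy0⟩ := exists_ne_zero_rootSp β
    exact lie_ne_zero_of_add_root hγ hx hx0 hy hy0
      (h x (rootSp_le_sumRootSp hα hx) y (rootSp_le_sumRootSp hβ hy))
  · intro h x hx y hy
    refine sumRootSp_induction (p := fun x => ⁅x, y⁆ = 0) (by simp) (fun α hα x hx => ?_)
      (fun x x' hx hx' => by rw [add_lie, hx, hx', add_zero]) hx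
    refine sumRootSp_induction (p := fun y => ⁅x, y⁆ = 0) (by simp) (fun β hβ y hy => ?_)
      (fun y y' hy hy' => by rw [lie_add, hy, hy', add_zero]) hy
    refine lie_eq_zero_of_add_not_root (fun γ hγ => ?_) (fun hne => ?_) hx hy
    · have h1 : γ ∈ rootSums (rootSystem H) Φ := ⟨α, hα, β, hβ, hγ⟩
      rw [h] at h1
      exact h1
    · have h1 := hgr.additive.eq_neg hne
      rw [hΦ.1 α hα, hΦ.1 β hβ] at h1
      lia

theorem bijOn_sumRootSp_abelian (hτ : τ ∈ alcoveX b) :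
    Set.BijOn sumRootSp {Φ | Φ ∈ stableSets (rootSystem H) b.height (level τ) ∧
      rootSums (rootSystem H) Φ = ∅} (abelianS b τ) := by
  refine ⟨fun Φ hΦ => ⟨sumRootSp_mem_submodulesS hτ hΦ.1, (sumRootSp_abelian_iff hτ hΦ.1).2 hΦ.2⟩,
    (bijOn_sumRootSp hτ).injOn.mono fun Φ hΦ => hΦ.1, fun s hs => ?_⟩
  obtain ⟨Φ, hΦ, rfl⟩ := (bijOn_sumRootSp hτ).surjOn hs.1
  exact ⟨Φ, ⟨hΦ, (sumRootSp_abelian_iff hτ hΦ).1 hs.2⟩, rfl⟩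

theorem weylTau_eq (hτ : τ ∈ coweights H) :
    weylTau τ = reflSubgroup (rootSystem H) {α | Even (level τ α)} := by
  rw [weylTau, reflSubgroup]
  congr 2
  ext α
  exact rootSp_le_kSub_iff hτ

end RootSpaces

end CompatibleDS

end

/-! ### Composition of the bijections, and the count. -/

theorem proposition3p10 {L : Type*} [LieRing L] [LieAlgebra ℂ L] [FiniteDimensional ℂ L]
    [LieAlgebra.IsSimple ℂ L] (H : LieSubalgebra ℂ L) [H.IsCartanSubalgebra]
    (b : (LieAlgebra.IsKilling.rootSystem H).Base)
    (τ : H) (hτ : τ ∈ CompatibleDS.alcoveX b) :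
    (∀ z ∈ CompatibleDS.coweights H, ∃! v, CompatibleDS.IsV b z v) ∧
    Set.BijOn (CompatibleDS.idealMap b) (CompatibleDS.hatZ b τ) (CompatibleDS.submodulesS b τ) ∧
    CompatibleDS.tildeZtau b τ ⊆ CompatibleDS.hatZ b τ ∧
    Set.BijOn (CompatibleDS.idealMap b) (CompatibleDS.tildeZtau b τ)
      (CompatibleDS.abelianS b τ) ∧
    (CompatibleDS.abelianS b τ).encard = (CompatibleDS.nTau τ : ℕ∞) := by
  open CompatibleDS in
  have hgr := isGrading_level hτ
  refine ⟨fun z hz => existsUnique_isV b hz, ?_, tildeZtau_subset_hatZ hτ, ?_, ?_⟩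
  · refine Set.BijOn.congr (((bijOn_sumRootSp hτ).comp (bijOn_levelOne_hatReps hgr)).comp
      (bijOn_vOf_hatZ hτ)) fun z hz => ?_
    exact (idealMap_eq hτ.1 hz.2).symm
  · refine Set.BijOn.congr (((bijOn_sumRootSp_abelian hτ).comp (bijOn_levelOne_abReps hgr)).comp
      (bijOn_vOf_tildeZtau hτ)) fun z hz => ?_
    exact (idealMap_eq hτ.1 hz.2).symm
  · have hbij := (bijOn_sumRootSp_abelian hτ).comp (bijOn_levelOne_abReps hgr)
    rw [nTau, weylTau_eq hτ.1, ← encard_abReps hgr, ← hbij.image_eq, hbij.injOn.encard_image]
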